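/- **Theorem.** If Boolean CSP (with constraints of unbounded arity) is solvable in nonuniform subexponential time, then so is CNF-Sat. *Boolean CSP.* An instance $I$ consists of variables $0,\dots,n-1$ and a finite list of constraints $(S,R)$, where $S$ is a nonempty sequence of distinct variables and $R\subseteq\{0,1\}^{|S|}$ is a set of tuples, listed explicitly. As usual, it is assumed that every variable occurs in some scope $S$ and that each of the values $0$ and $1$ occurs in some relation $R$. The question is whether there is an assignment $\tau:\{0,\dots,n-1\}\to\{0,1\}$ with $(\tau(x_1),\dots,\tau(x_r))\in R$ for every constraint $((x_1,\dots,x_r),R)$. The size of $I$ is $|I|=\sum_{(S,R)}|S|\cdot|R|$. *CNF-Sat.* An instance $F$ consists of variables $0,\dots,n-1$ and a finite list of clauses, each of which is a finite list of literals over these variables. The question is whether some truth assignment makes at least one literal of every clause true. The size of $F$ is $|F|=\sum_{C}(|C|+1)$, the number of clauses plus the number of literal occurrences. *Nonuniform subexponential time.* Each of the two problems is solvable in nonuniform subexponential time if for every $\epsilon=1/\ell$, where $\ell$ is a positive integer, there are an algorithm $A_\epsilon$ and a constant $c_\epsilon$ such that $A_\epsilon$ decides every instance $I$ with $n$ variables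 in at most $c_\epsilon\cdot 2^{\epsilon n}\cdot(|I|+1)^{c_\epsilon}$ steps, that is, in time $2^{\epsilon n}|I|^{O(1)}$. Both the algorithm and the constant may depend on $\epsilon$. *Algorithms.* Algorithms are while-programs over unlabelled binary trees with unit-cost operations: the identity, the empty tree, the left and the right subtree, pairing of the outputs of two programs, sequential composition, and branching and looping on whether a program returns a nonempty tree. This model is polynomially related in running time to Turing machines. Instances are given as nested linked lists (with variable indices as unary chains), and a nonempty output means acceptance. -/

import Mathlib

/-! ## The machine model: while-programs on binary trees, with a unit-cost step count -/

/-- The data manipulated by programs: binary trees without labels. -/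
inductive BinTree where
  | nil : BinTree
  | node : BinTree → BinTree → BinTree

namespace BinTree

/-- The left subtree (`nil` has the left subtree `nil`). -/
def left : BinTree → BinTree
  | nil => nil
  | node a _ => a

/-- The right subtree (`nil` has the right subtree `nil`). -/
def right : BinTree → BinTree
  | nil => nil
  | node _ b => b

end BinTree

/-- While-programs. A program works on one binary tree, which it transforms. -/
inductive WhileProg where
  /-- leave the tree unchanged -/
  | skip : WhileProg
  /-- return the empty tree -/
  | empty : WhileProg
  /-- return the left subtree -/
  | left : WhileProg
  /-- return the right subtree -/
  | right : WhileProg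
  /-- run both programs on the same input, and return the tree with the two outputs as subtrees -/
  | pair : WhileProg → WhileProg → WhileProg
  /-- run the first program, then the second one on its output -/
  | seq : WhileProg → WhileProg → WhileProg
  /-- `branch c p q`: run `p` on the input if `c` returns a nonempty tree on it, otherwise `q` -/
  | branch : WhileProg → WhileProg → WhileProg → WhileProg
  /-- `loop c p`: as long as `c` returns a nonempty tree on the current tree, apply `p` to it -/
  | loop : WhileProg → WhileProg → WhileProg

/-- `p.Runs x y t`: the program `p`, started on the tree `x`, halts with output `y` after exactly
`t` elementary steps. Every operation costs one step, and one step creates at most one new node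
and inspects at most the root of one tree, so that (with trees stored as linked nodes) this count
is polynomially related to the running time of Turing machines and of random access machines. -/
inductive WhileProg.Runs : WhileProg → BinTree → BinTree → ℕ → Prop where
  | skip (x : BinTree) : Runs .skip x x 1
  | empty (x : BinTree) : Runs .empty x .nil 1
  | left (x : BinTree) : Runs .left x x.left 1
  | right (x : BinTree) : Runs .right x x.right 1
  | pair {p q : WhileProg} {x a b : BinTree} {s t : ℕ} :
      Runs p x a s → Runs q x b t → Runs (.pair p q) x (.node a b) (s + t + 1)
  | seq {p q : WhileProg} {x y z : BinTree} {s t : ℕ} :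
      Runs p x y s → Runs q y z t → Runs (.seq p q) x z (s + t + 1)
  | branch_true {c p q : WhileProg} {x a b y : BinTree} {s t : ℕ} :
      Runs c x (.node a b) s → Runs p x y t → Runs (.branch c p q) x y (s + t + 1)
  | branch_false {c p q : WhileProg} {x y : BinTree} {s t : ℕ} :
      Runs c x .nil s → Runs q x y t → Runs (.branch c p q) x y (s + t + 1)
  | loop_step {c p : WhileProg} {x a b y z : BinTree} {s t u : ℕ} :
      Runs c x (.node a b) s → Runs p x y t → Runs (.loop c p) y z u →
        Runs (.loop c p) x z (s + t + u + 1)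
  | loop_stop {c p : WhileProg} {x : BinTree} {s : ℕ} :
      Runs c x .nil s → Runs (.loop c p) x x (s + 1)

/-- Programs are deterministic: the output and the number of steps are determined by the input. -/
theorem WhileProg.Runs.deterministic {p : WhileProg} {x y : BinTree} {t : ℕ}
    (h : p.Runs x y t) : ∀ {y' : BinTree} {t' : ℕ}, p.Runs x y' t' → y = y' ∧ t = t' := by
  induction h with
  | skip x => intro y' t' h'; cases h'; exact ⟨rfl, rfl⟩
  | empty x => intro y' t' h'; cases h'; exact ⟨rfl, rfl⟩
  | left x => intro y' t' h'; cases h'; exact ⟨rfl, rfl⟩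
  | right x => intro y' t' h'; cases h'; exact ⟨rfl, rfl⟩
  | pair _ _ ih1 ih2 =>
      intro y' t' h'
      cases h' with
      | pair k1 k2 =>
        obtain ⟨rfl, rfl⟩ := ih1 k1
        obtain ⟨rfl, rfl⟩ := ih2 k2
        exact ⟨rfl, rfl⟩
  | seq _ _ ih1 ih2 =>
      intro y' t' h'
      cases h' with
      | seq k1 k2 =>
        obtain ⟨rfl, rfl⟩ := ih1 k1
        obtain ⟨rfl, rfl⟩ := ih2 k2
        exact ⟨rfl, rfl⟩
  | branch_true _ _ ih1 ih2 =>
      intro y' t' h'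
      cases h' with
      | branch_true k1 k2 =>
        obtain ⟨_, rfl⟩ := ih1 k1
        obtain ⟨rfl, rfl⟩ := ih2 k2
        exact ⟨rfl, rfl⟩
      | branch_false k1 k2 => exact absurd (ih1 k1).1 (by simp)
  | branch_false _ _ ih1 ih2 =>
      intro y' t' h'
      cases h' with
      | branch_true k1 k2 => exact absurd (ih1 k1).1 (by simp)
      | branch_false k1 k2 =>
        obtain ⟨_, rfl⟩ := ih1 k1
        obtain ⟨rfl, rfl⟩ := ih2 k2
        exact ⟨rfl, rfl⟩
  | loop_step _ _ _ ih1 ih2 ih3 =>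
      intro y' t' h'
      cases h' with
      | loop_step k1 k2 k3 =>
        obtain ⟨_, rfl⟩ := ih1 k1
        obtain ⟨rfl, rfl⟩ := ih2 k2
        obtain ⟨rfl, rfl⟩ := ih3 k3
        exact ⟨rfl, rfl⟩
      | loop_stop k1 => exact absurd (ih1 k1).1 (by simp)
  | loop_stop _ ih1 =>
      intro y' t' h'
      cases h' with
      | loop_step k1 k2 k3 => exact absurd (ih1 k1).1 (by simp)
      | loop_stop k1 =>
        obtain ⟨_, rfl⟩ := ih1 k1
        exact ⟨rfl, rfl⟩

/-! ## Encoding of inputs as trees -/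

namespace BinTree

/-- Truth values: `false` is the empty tree, `true` is a single node. -/
def ofBool : Bool → BinTree
  | false => nil
  | true => node nil nil

/-- Natural numbers, as chains of nodes. -/
def ofNat : ℕ → BinTree
  | 0 => nil
  | k + 1 => node nil (ofNat k)

/-- Lists, as linked lists. -/
def ofList {α : Type} (enc : α → BinTree) : List α → BinTree
  | [] => nil
  | a :: l => node (enc a) (ofList enc l)

end BinTree

/-! ## CNF-Sat -/

/-- A propositional formula in conjunctive normal form, over the variables `0, …, numVars - 1`:
a list of clauses, each of which is a list of literals. The literal `(x, b)` says that the
variable `x` has the value `b`. -/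
structure CNFFormula where
  numVars : ℕ
  clauses : List (List (Fin numVars × Bool))

namespace CNFFormula

/-- Some truth assignment makes at least one literal of every clause true. -/
def Satisfiable (F : CNFFormula) : Prop :=
  ∃ τ : Fin F.numVars → Bool, ∀ C ∈ F.clauses, ∃ l ∈ C, τ l.1 = l.2

/-- The length of the formula: the number of clauses plus the number of literal occurrences. -/
def size (F : CNFFormula) : ℕ :=
  (F.clauses.map fun C => C.length + 1).sum

/-- The input tree for the formula. -/
def encode (F : CNFFormula) : BinTree :=
  .node (.ofNat F.numVars)
    (.ofList (.ofList fun l => .node (.ofNat l.1.val) (.ofBool l.2)) F.clauses)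

end CNFFormula

/-! ## Boolean CSP (unbounded arity) -/

/-- A constraint `(S, R)` over the Boolean domain: a nonempty sequence `S` of distinct variables
and a set `R` of tuples of length `|S|`, listed explicitly and without repetition. -/
structure BoolConstraint (n : ℕ) where
  scope : List (Fin n)
  rel : List (List Bool)
  scope_ne_nil : scope ≠ []
  scope_nodup : scope.Nodup
  rel_nodup : rel.Nodup
  rel_length : ∀ a ∈ rel, a.length = scope.length

/-- An instance of Boolean CSP with the variables `0, …, numVars - 1` and the domain `{0, 1}`.
Every variable occurs in a scope, and every domain value occurs in a relation. -/
structure BoolCSP where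
  numVars : ℕ
  constraints : List (BoolConstraint numVars)
  var_occurs : ∀ x : Fin numVars, ∃ c ∈ constraints, x ∈ c.scope
  value_occurs : ∀ b : Bool, ∃ c ∈ constraints, ∃ a ∈ c.rel, b ∈ a

namespace BoolCSP

/-- Some assignment `τ` has `(τ x₁, …, τ xᵣ) ∈ R` for every constraint `((x₁, …, xᵣ), R)`. -/
def Consistent (I : BoolCSP) : Prop :=
  ∃ τ : Fin I.numVars → Bool, ∀ c ∈ I.constraints, c.scope.map τ ∈ c.rel

/-- The size of the instance: the sum of `|S| * |R|` over its constraints `(S, R)`. -/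
def size (I : BoolCSP) : ℕ :=
  (I.constraints.map fun c => c.scope.length * c.rel.length).sum

/-- The input tree for the instance. -/
def encode (I : BoolCSP) : BinTree :=
  .node (.ofNat I.numVars)
    (.ofList
      (fun c => .node (.ofList (fun x => .ofNat x.val) c.scope)
        (.ofList (.ofList .ofBool) c.rel))
      I.constraints)

end BoolCSP

/-! ## Nonuniform subexponential time -/

/-- The decision problem with the instances `Inst`, encoded by `enc`, with the yes-instances `yes`,
the number of variables `vars` and the instance size `size`, is solvable in nonuniform
subexponential time: for every `ε = 1 / ℓ` with a positive integer `ℓ` there is a program (which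
may depend on `ε`) that decides the problem in time `2 ^ (ε n) * |I| ^ O(1)`.
A nonempty output means acceptance. The base `|I| + 1` avoids the value `0` on instances
of size `0`. -/
def NonuniformSubexp {Inst : Type} (enc : Inst → BinTree) (yes : Inst → Prop)
    (vars size : Inst → ℕ) : Prop :=
  ∀ ℓ : ℕ, 0 < ℓ → ∃ (A : WhileProg) (c : ℕ), ∀ I : Inst, ∃ (out : BinTree) (t : ℕ),
    A.Runs (enc I) out t ∧ (out ≠ BinTree.nil ↔ yes I) ∧
      (t : ℝ) ≤ c * (2 : ℝ) ^ ((1 / (ℓ : ℝ)) * (vars I : ℝ)) * ((size I : ℝ) + 1) ^ c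

/-- Boolean CSP has a nonuniform subexponential-time algorithm. -/
def BooleanCSPNonuniformSubexp : Prop :=
  NonuniformSubexp BoolCSP.encode BoolCSP.Consistent BoolCSP.numVars BoolCSP.size

/-- CNF-Sat has a nonuniform subexponential-time algorithm. -/
def CNFSatNonuniformSubexp : Prop :=
  NonuniformSubexp CNFFormula.encode CNFFormula.Satisfiable CNFFormula.numVars CNFFormula.size

/-! ## Programs with polynomial running time on families of trees -/

open BinTree WhileProg

/-! The obstacle to reading a CNF formula as a Boolean CSP is that a clause with `w` literals has `2
^ w - 1` satisfying tuples, all of which must be listed. Long clauses are therefore first removed by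
branching, as in Schuler's algorithm. Let the formula have `n` variables and `m` clauses, and let `k
= q * Nat.size (m + 2)`. If a clause has more than `k` literals not yet assumed false, select `k` of
them. Either one of these is true, and the clause may be replaced by the selection, or all are
false, and `k` further literals are fixed (`sat_iff_children`). The second case occurs at most `(2 *
n + 1) / k` times on a path, and the first disposes of a clause. The potential `weight` turns this
into at most `(m + 1) * 2 ^ ((2 * n + 1) / q)` nodes (`weight_children`, `weight_root_le`).

At a leaf every clause has at most `k` literals, and `2 ^ (k + 1)` is polynomial in `m` for fixed
`q`. Taking the literals as CSP variables turns all clauses of one length into the same relation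
"not all false"; complementary literals are linked by disequalities. This gives an equivalent
instance of polynomial size with `2 * n + 2` variables (`consistent_csp_iff`, `size_csp_le`), which
the assumed algorithm for `ε = 1 / q` decides in time about `2 ^ (2 * n / q)`.

Tree and leaves together cost `2 ^ (4 * n / q)` times a polynomial in `n` and the size of the
formula (`exists_cnfSat_program`); `q = 6 * ℓ` leaves room to absorb the polynomial in `n`.

The remaining work is to realize this by while-programs. `PolyMap` is closed under composition,
pairing, branching and bounded iteration. As operations have unit cost, only step counts are
tracked, not the sizes of trees. -/

/-- One program maps `f i` to `g i` for every `i`, in time polynomial in `N i`. -/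
def PolyMap {ι : Type} (N : ι → ℕ) (f g : ι → BinTree) : Prop :=
  ∃ (p : WhileProg) (c : ℕ), ∀ i, ∃ t, p.Runs (f i) (g i) t ∧ t ≤ (N i + 2) ^ c

/-- Bounds of the form `X ^ c` survive the rule "sum of the parts plus one", by which pairs,
sequences and branches are charged. -/
theorem add_add_one_le_pow {a b X c d : ℕ} (hX : 2 ≤ X) (ha : a ≤ X ^ c) (hb : b ≤ X ^ d) :
    a + b + 1 ≤ X ^ (c + d + 2) := by
  have h1 : X ^ c ≤ X ^ (c + d) := Nat.pow_le_pow_right (by omega) (by omega)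
  have h2 : X ^ d ≤ X ^ (c + d) := Nat.pow_le_pow_right (by omega) (by omega)
  have h3 : 1 ≤ X ^ (c + d) := Nat.one_le_pow _ _ (by omega)
  have h4 : 4 ≤ X ^ 2 := by nlinarith
  rw [pow_add X (c + d) 2]
  nlinarith

namespace PolyMap

variable {ι κ : Type} {N : ι → ℕ} {e f g h x y : ι → BinTree}

theorem congr (hf : PolyMap N f g) {f' g' : ι → BinTree} (h1 : ∀ i, f i = f' i)
    (h2 : ∀ i, g i = g' i) : PolyMap N f' g' := by
  obtain rfl : f = f' := funext h1
  obtain rfl : g = g' := funext h2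
  exact hf

theorem of_step (p : WhileProg) (hp : ∀ i, p.Runs (f i) (g i) 1) : PolyMap N f g :=
  ⟨p, 0, fun i => ⟨1, hp i, by simp⟩⟩

theorem id : PolyMap N f f := of_step .skip fun _ => .skip _

theorem comp (h1 : PolyMap N f g) (h2 : PolyMap N g h) : PolyMap N f h := by
  obtain ⟨p, c, hp⟩ := h1
  obtain ⟨q, d, hq⟩ := h2
  refine ⟨.seq p q, c + d + 2, fun i => ?_⟩
  obtain ⟨s, hs, hs'⟩ := hp i
  obtain ⟨t, ht, ht'⟩ := hq i
  exact ⟨_, .seq hs ht, add_add_one_le_pow (by omega) hs' ht'⟩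

theorem node (h1 : PolyMap N f g) (h2 : PolyMap N f h) :
    PolyMap N f (fun i => .node (g i) (h i)) := by
  obtain ⟨p, c, hp⟩ := h1
  obtain ⟨q, d, hq⟩ := h2
  refine ⟨.pair p q, c + d + 2, fun i => ?_⟩
  obtain ⟨s, hs, hs'⟩ := hp i
  obtain ⟨t, ht, ht'⟩ := hq i
  exact ⟨_, .pair hs ht, add_add_one_le_pow (by omega) hs' ht'⟩

theorem left (h1 : PolyMap N f (fun i => .node (g i) (h i))) : PolyMap N f g :=
  h1.comp (of_step .left fun _ => .left _)

theorem right (h1 : PolyMap N f (fun i => .node (g i) (h i))) : PolyMap N f h :=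
  h1.comp (of_step .right fun _ => .right _)

theorem const (t : BinTree) : PolyMap N f (fun _ => t) := by
  induction t with
  | nil => exact of_step .empty fun i => .empty _
  | node a b iha ihb => exact iha.node ihb

theorem reindex (π : κ → ι) (h1 : PolyMap N f g) :
    PolyMap (fun j => N (π j)) (fun j => f (π j)) (fun j => g (π j)) := by
  obtain ⟨p, c, hp⟩ := h1
  exact ⟨p, c, fun j => hp (π j)⟩

theorem mono {N' : ι → ℕ} (h1 : PolyMap N f g) (d : ℕ) (hN : ∀ i, N i ≤ (N' i + 2) ^ d) :
    PolyMap N' f g := by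
  obtain ⟨p, c, hp⟩ := h1
  -- `N i + 2` is read as `N i + 1 + 1`, with `1` bounded by a zeroth power.
  refine ⟨p, (d + 0 + 2) * c, fun i => ?_⟩
  obtain ⟨t, ht, ht'⟩ := hp i
  refine ⟨t, ht, ht'.trans ?_⟩
  rw [pow_mul]
  exact Nat.pow_le_pow_left
    (add_add_one_le_pow (b := 1) (d := 0) (by omega) (hN i) (by simp)) c

/-- Programs on a fixed tree also work on this tree as a component of an environment. -/
theorem lift (π : κ → ι) (A : κ → BinTree) (h1 : PolyMap N e x) :
    PolyMap (fun j => N (π j)) (fun j => .node (A j) (e (π j))) (fun j => x (π j)) :=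
  (right id).comp (h1.reindex π)

theorem ite_tree {c : ι → BinTree} {P : ι → Prop} [DecidablePred P] (hc : PolyMap N e c)
    (hP : ∀ i, P i ↔ c i ≠ .nil) (hx : PolyMap N e x) (hy : PolyMap N e y) :
    PolyMap N e (fun i => if P i then x i else y i) := by
  obtain ⟨p, a, hp⟩ := hc
  obtain ⟨q, b, hq⟩ := hx
  obtain ⟨r, d, hr⟩ := hy
  refine ⟨.branch p q r, a + (b + d) + 2, fun i => ?_⟩
  obtain ⟨s, hs, hs'⟩ := hp i
  obtain ⟨t, ht, ht'⟩ := hq i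
  obtain ⟨u, hu, hu'⟩ := hr i
  rcases hci : c i with _ | ⟨l, m⟩
  · rw [hci] at hs
    beta_reduce
    rw [show (if P i then x i else y i) = y i from if_neg (by simp [hP, hci])]
    exact ⟨_, .branch_false hs hu, add_add_one_le_pow (by omega) hs'
      (hu'.trans (Nat.pow_le_pow_right (by omega) (by omega)))⟩
  · rw [hci] at hs
    beta_reduce
    rw [show (if P i then x i else y i) = x i from if_pos (by simp [hP, hci])]
    exact ⟨_, .branch_true hs ht, add_add_one_le_pow (by omega) hs'
      (ht'.trans (Nat.pow_le_pow_right (by omega) (by omega)))⟩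

theorem ite {P : ι → Prop} [DecidablePred P] (hc : PolyMap N e (fun i => .ofBool (P i)))
    (hx : PolyMap N e x) (hy : PolyMap N e y) :
    PolyMap N e (fun i => if P i then x i else y i) :=
  hc.ite_tree (fun i => by by_cases hi : P i <;> simp [hi, ofBool]) hx hy

/-- A loop with a polynomial number of rounds, controlled by the left subtree. -/
theorem loop {T R : ι → ℕ → BinTree} {len : ι → ℕ} (hlen : ∀ i, len i ≤ N i)
    (hT : ∀ i j, j < len i → T i j ≠ .nil) (hT' : ∀ i, T i (len i) = .nil)
    (hstep : ∀ (κ : Type) (π : κ → ι) (j : κ → ℕ), (∀ a, j a < len (π a)) →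
      PolyMap (fun a => N (π a)) (fun a => .node (T (π a) (j a)) (R (π a) (j a)))
        (fun a => .node (T (π a) (j a + 1)) (R (π a) (j a + 1)))) :
    PolyMap N (fun i => .node (T i 0) (R i 0)) (fun i => R i (len i)) := by
  -- The step hypothesis is applied to the universal family of all pairs of an instance and a round.
  -- This yields one program and one exponent for all rounds, so exponents do not accumulate.
  obtain ⟨p, c, hp⟩ := hstep {a : ι × ℕ // a.2 < len a.1} (fun a => a.1.1) (fun a => a.1.2)
    (fun a => a.2)
  suffices H : PolyMap N (fun i => .node (T i 0) (R i 0))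
      (fun i => .node (T i (len i)) (R i (len i))) from H.right
  refine ⟨.loop .left p, c + 4, fun i => ?_⟩
  have key : ∀ m j, j + m = len i → ∃ t, (WhileProg.loop .left p).Runs (.node (T i j) (R i j))
      (.node (T i (len i)) (R i (len i))) t ∧ t ≤ m * ((N i + 2) ^ c + 2) + 2 := by
    intro m
    induction m with
    | zero =>
      intro j hj
      obtain rfl : j = len i := by omega
      refine ⟨_, WhileProg.Runs.loop_stop (s := 1) ?_, by omega⟩
      have := Runs.left (.node (T i (len i)) (R i (len i)))
      rw [BinTree.left, hT'] at this
      rwa [hT']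
    | succ m ih =>
      intro j hj
      obtain ⟨t, ht, ht'⟩ := ih (j + 1) (by omega)
      obtain ⟨s, hs, hs'⟩ := hp ⟨(i, j), by show j < len i; omega⟩
      have h1 := Runs.left (.node (T i j) (R i j))
      rw [BinTree.left] at h1
      rcases hTj : T i j with _ | ⟨a, b⟩
      · exact absurd hTj (hT i j (by omega))
      · simp only [hTj] at h1 hs hs'
        refine ⟨_, .loop_step h1 hs ht, ?_⟩
        rw [Nat.succ_mul]
        omega
  obtain ⟨t, ht, ht'⟩ := key (len i) 0 (by omega)
  refine ⟨t, ht, ht'.trans ?_⟩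
  have h0 := hlen i
  have h1 : 1 ≤ (N i + 2) ^ c := Nat.one_le_pow _ _ (by omega)
  calc len i * ((N i + 2) ^ c + 2) + 2 ≤ N i * (3 * (N i + 2) ^ c) + 2 * (N i + 2) ^ c := by
        gcongr <;> omega
    _ = (N i + 2) ^ c * (3 * N i + 2) := by ring
    _ ≤ (N i + 2) ^ c * (N i + 2) ^ 4 := by
        gcongr
        nlinarith [sq_nonneg (N i), Nat.zero_le (N i ^ 3), Nat.zero_le (N i ^ 4)]
    _ = (N i + 2) ^ (c + 4) := by ring

/-- Iteration as often as a number in unary says. -/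
theorem iter {s : ι → ℕ → BinTree} {len : ι → ℕ} (hlen : ∀ i, len i ≤ N i)
    (hn : PolyMap N e (fun i => .ofNat (len i))) (h0 : PolyMap N e (fun i => s i 0))
    (hstep : ∀ (κ : Type) (π : κ → ι) (j : κ → ℕ), (∀ a, j a < len (π a)) →
      PolyMap (fun a => N (π a)) (fun a => .node (s (π a) (j a)) (e (π a)))
        (fun a => s (π a) (j a + 1))) :
    PolyMap N e (fun i => s i (len i)) := by
  -- The number of remaining rounds, in unary, is itself the loop test. The environment `e i` is
  -- carried along unchanged for use in each step.
  have := loop (T := fun i j => .ofNat (len i - j)) (R := fun i j => .node (s i j) (e i)) hlen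
    (by
      intro i j hj
      obtain ⟨m, hm⟩ : ∃ m, len i - j = m + 1 := ⟨len i - j - 1, by omega⟩
      simp [hm, ofNat])
    (by intro i; simp [ofNat])
    (by
      intro κ π j hj
      refine PolyMap.node ?_ (PolyMap.node (.comp (.right .id) (hstep κ π j hj))
        (.right (.right .id)))
      refine .right (g := fun _ => .nil) (.congr (.left .id) (fun _ => rfl) fun a => ?_)
      have := hj a
      obtain ⟨m, hm⟩ : ∃ m, len (π a) - j a = m + 1 := ⟨len (π a) - j a - 1, by omega⟩
      rw [hm, show len (π a) - (j a + 1) = m by omega, ofNat])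
  exact (((hn.congr (fun _ => rfl) fun i => by simp).node (h0.node .id)).comp this).left

/-- A fold over a linked list. -/
theorem foldl {α β : Type} {enc : α → BinTree} {encβ : β → BinTree} {L : ι → List α}
    {init : ι → β} {step : ι → β → α → β} (hlen : ∀ i, (L i).length ≤ N i)
    (hL : PolyMap N e (fun i => .ofList enc (L i)))
    (h0 : PolyMap N e (fun i => encβ (init i)))
    (hstep : ∀ (κ : Type) (π : κ → ι) (pre : κ → List α) (a : κ → α) (suf : κ → List α),
      (∀ j, L (π j) = pre j ++ a j :: suf j) →
      PolyMap (fun j => N (π j))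
        (fun j => .node (.node (encβ ((pre j).foldl (step (π j)) (init (π j)))) (enc (a j)))
          (e (π j)))
        (fun j => encβ (step (π j) ((pre j).foldl (step (π j)) (init (π j))) (a j)))) :
    PolyMap N e (fun i => encβ ((L i).foldl (step i) (init i))) := by
  have := loop (T := fun i j => .ofList enc ((L i).drop j))
    (R := fun i j => .node (encβ (((L i).take j).foldl (step i) (init i))) (e i)) hlen
    (by
      intro i j hj
      rw [List.drop_eq_getElem_cons hj]
      simp [ofList])
    (by intro i; simp [ofList])
    (by
      intro κ π j hj
      have h1 := hstep κ π (fun a => (L (π a)).take (j a)) (fun a => (L (π a))[j a]'(hj a))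
        (fun a => (L (π a)).drop (j a + 1)) (by
          intro a
          rw [← List.drop_eq_getElem_cons (hj a), List.take_append_drop])
      have h2 : PolyMap (fun a => N (π a))
          (fun a => .node (.ofList enc ((L (π a)).drop (j a)))
            (.node (encβ (((L (π a)).take (j a)).foldl (step (π a)) (init (π a)))) (e (π a))))
          (fun a => .node (enc ((L (π a))[j a]'(hj a)))
            (.ofList enc ((L (π a)).drop (j a + 1)))) :=
        .congr (.left .id) (fun _ => rfl) fun a => by
          rw [List.drop_eq_getElem_cons (hj a), ofList]
      refine PolyMap.node h2.right (PolyMap.node ?_ (.right (.right .id)))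
      refine PolyMap.congr (.comp (.node (.node (.left (.right .id)) h2.left)
        (.right (.right .id))) h1) (fun _ => rfl) fun a => ?_
      rw [List.take_succ_eq_append_getElem (hj a), List.foldl_append, List.foldl_cons,
        List.foldl_nil])
  refine (((hL.congr (fun _ => rfl) fun i => by simp).node
    (h0.node .id)).comp this).left.congr (fun _ => rfl) fun i => by simp

/-! ### Arithmetic and lists -/

theorem zero : PolyMap N e (fun _ => .ofNat 0) := const .nil

theorem succ {a : ι → ℕ} (ha : PolyMap N e (fun i => .ofNat (a i))) :
    PolyMap N e (fun i => .ofNat (a i + 1)) :=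
  (const .nil).node ha

theorem addConst {a : ι → ℕ} (ha : PolyMap N e (fun i => .ofNat (a i))) (q : ℕ) :
    PolyMap N e (fun i => .ofNat (a i + q)) := by
  induction q with
  | zero => exact ha
  | succ q ih => exact ih.succ

theorem pred {a : ι → ℕ} (ha : PolyMap N e (fun i => .ofNat (a i))) :
    PolyMap N e (fun i => .ofNat (a i - 1)) :=
  ha.comp (of_step .right fun i => by
    have := Runs.right (.ofNat (a i))
    rcases h : a i with _ | m <;> rw [h] at this <;> exact this)

theorem ite_ne_zero {a : ι → ℕ} (ha : PolyMap N e (fun i => .ofNat (a i)))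
    (hx : PolyMap N e x) (hy : PolyMap N e y) :
    PolyMap N e (fun i => if a i ≠ 0 then x i else y i) :=
  ha.ite_tree (fun i => by rcases a i with _ | m <;> simp [ofNat]) hx hy

theorem double {a : ι → ℕ} (ha : PolyMap N e (fun i => .ofNat (a i))) (hN : ∀ i, a i ≤ N i) :
    PolyMap N e (fun i => .ofNat (2 * a i)) :=
  iter (s := fun _ j => .ofNat (2 * j)) hN ha zero fun _ _ _ _ =>
    (addConst (.left .id) 2).congr (fun _ => rfl) fun _ => rfl

theorem half {a : ι → ℕ} (ha : PolyMap N e (fun i => .ofNat (a i))) (hN : ∀ i, a i ≤ N i) :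
    PolyMap N e (fun i => .ofNat (a i / 2)) := by
  -- Halving by counting: the pair `(j / 2, (j + 1) / 2)` is advanced by swapping and one increment.
  have := iter (s := fun _ j => .node (.ofNat (j / 2)) (.ofNat ((j + 1) / 2))) hN ha
    (zero.node zero) fun _ _ _ _ =>
      (PolyMap.node (.right (.left .id)) (succ (.left (.left .id)))).congr (fun _ => rfl)
        fun a => by congr 2; omega
  exact this.left

theorem le {a b : ι → ℕ} (ha : PolyMap N e (fun i => .ofNat (a i)))
    (hb : PolyMap N e (fun i => .ofNat (b i))) (hN : ∀ i, a i ≤ N i) :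
    PolyMap N e (fun i => .ofBool (a i ≤ b i)) := by
  have h1 : PolyMap N e (fun i => .ofNat (b i + 1 - a i)) :=
    iter (s := fun i j => .ofNat (b i + 1 - j)) hN ha hb.succ fun _ _ _ _ =>
      (pred (.left .id)).congr (fun _ => rfl) fun a => by rw [Nat.sub_sub]
  refine (h1.ite_ne_zero (const (.ofBool true)) (const (.ofBool false))).congr (fun _ => rfl)
    fun i => ?_
  by_cases h : a i ≤ b i
  · rw [if_pos (by omega)]; simp [h]
  · rw [if_neg (by omega)]; simp [h]

theorem eq {a b : ι → ℕ} (ha : PolyMap N e (fun i => .ofNat (a i)))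
    (hb : PolyMap N e (fun i => .ofNat (b i))) (hN : ∀ i, a i ≤ N i) (hN' : ∀ i, b i ≤ N i) :
    PolyMap N e (fun i => .ofBool (a i = b i)) := by
  refine ((le ha hb hN).ite (le hb ha hN') (const (.ofBool false))).congr (fun _ => rfl)
    fun i => ?_
  by_cases h : a i ≤ b i
  · rw [if_pos h]; congr 2; apply propext; omega
  · rw [if_neg h]; congr 1; symm; simp; omega

theorem listNil {α : Type} {enc : α → BinTree} : PolyMap N e (fun _ => .ofList enc []) :=
  const .nil

theorem listCons {α : Type} {enc : α → BinTree} {a : ι → α} {L : ι → List α}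
    (ha : PolyMap N e (fun i => enc (a i))) (hL : PolyMap N e (fun i => .ofList enc (L i))) :
    PolyMap N e (fun i => .ofList enc (a i :: L i)) :=
  ha.node hL

theorem mem {a : ι → ℕ} {L : ι → List ℕ} (ha : PolyMap N e (fun i => .ofNat (a i)))
    (hL : PolyMap N e (fun i => .ofList .ofNat (L i))) (hN : ∀ i, a i ≤ N i)
    (hlen : ∀ i, (L i).length ≤ N i) (hN' : ∀ i, ∀ b ∈ L i, b ≤ N i) :
    PolyMap N e (fun i => .ofBool (a i ∈ L i)) := by
  refine (foldl (encβ := ofBool) (init := fun _ => false)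
    (step := fun i b l => if a i = l then true else b) hlen hL (const (.ofBool false)) ?_).congr
    (fun _ => rfl) fun i => ?_
  · intro κ π pre l suf hl
    refine (ite (P := fun j => a (π j) = l j) (eq (ha.lift π _) (.right (.left .id))
      (fun j => hN _) (fun j => hN' _ _ (by simp [hl j]))) (const (.ofBool true))
      (.left (.left .id))).congr (fun _ => rfl) fun j => ?_
    split_ifs <;> rfl
  · congr 1
    suffices ∀ (L : List ℕ) (b : Bool),
        L.foldl (fun b l => if a i = l then true else b) b = (b || decide (a i ∈ L)) by
      simpa using this (L i) false
    intro L
    induction L with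
    | nil => simp
    | cons l L ih =>
      intro b
      rw [List.foldl_cons, ih]
      by_cases h : a i = l <;> simp [h]

/-- A fold that builds a list by consing reverses it. The definitions below carry `.reverse` so that
they agree literally with what the programs produce. -/
theorem foldl_cons_eq_reverse_map {α β : Type} (φ : α → β) (L : List α) (acc : List β) :
    L.foldl (fun b a => φ a :: b) acc = (L.map φ).reverse ++ acc := by
  induction L generalizing acc with
  | nil => rfl
  | cons a L ih => simp [ih]

/-- The images of the elements of a list, in reverse order, put in front of another list. -/
theorem mapOnto {α β : Type} {enc : α → BinTree} {encβ : β → BinTree} {L : ι → List α}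
    {acc : ι → List β} {φ : ι → α → β} (hlen : ∀ i, (L i).length ≤ N i)
    (hL : PolyMap N e (fun i => .ofList enc (L i)))
    (h0 : PolyMap N e (fun i => .ofList encβ (acc i)))
    (hstep : ∀ (κ : Type) (π : κ → ι) (a : κ → α), (∀ j, a j ∈ L (π j)) →
      PolyMap (fun j => N (π j)) (fun j => .node (enc (a j)) (e (π j)))
        (fun j => encβ (φ (π j) (a j)))) :
    PolyMap N e (fun i => .ofList encβ (((L i).map (φ i)).reverse ++ acc i)) := by
  refine (foldl (encβ := ofList encβ) (step := fun i b a => φ i a :: b) hlen hL h0 ?_).congr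
    (fun _ => rfl) fun i => by rw [foldl_cons_eq_reverse_map]
  intro κ π pre a suf h
  exact listCons (.comp (.node (.right (.left .id)) (.right .id))
    (hstep κ π a fun j => by simp [h j])) (.left (.left .id))

end PolyMap

/-! ## Branching on long clauses

The literals of a formula over `n` variables are numbered: `2 * x` stands for `¬ x` and `2 * x + 1`
for `x`. The variables of the constraint satisfaction problem are the literals of `n + 1`
variables; the literal `2 * n` is always made false. -/

/-- A node of the branching tree: the clauses still to be treated, the literals that are assumed
to be false, and the short clauses obtained so far. -/
structure BranchState where
  todo : List (List ℕ)
  falses : List ℕ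
  short : List (List ℕ)

/-- `σ` gives opposite values to complementary literals. -/
def IsLiteralAssignment (n : ℕ) (σ : ℕ → Bool) : Prop :=
  ∀ x ≤ n, σ (2 * x + 1) = !σ (2 * x)

namespace BranchState

def Sat (n : ℕ) (s : BranchState) : Prop :=
  ∃ σ : ℕ → Bool, IsLiteralAssignment n σ ∧ (∀ l ∈ s.falses, σ l = false) ∧
    (∀ C ∈ s.todo, ∃ l ∈ C, σ l = true) ∧ ∀ C ∈ s.short, ∃ l ∈ C, σ l = true

/-- The invariant of the branching algorithm, with a bound `B` on all relevant quantities. -/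
structure Good (n k B : ℕ) (s : BranchState) : Prop where
  vars_le : 2 * n + 2 ≤ B
  width_le : 2 ^ (k + 1) ≤ B
  falses_nodup : s.falses.Nodup
  falses_lt : ∀ l ∈ s.falses, l < 2 * n + 2
  dummy_mem : 2 * n ∈ s.falses
  todo_lt : ∀ C ∈ s.todo, ∀ l ∈ C, l < 2 * n + 2
  todo_length : ∀ C ∈ s.todo, C.length ≤ B
  short_lt : ∀ C ∈ s.short, ∀ l ∈ C, l < 2 * n + 2
  short_nodup : ∀ C ∈ s.short, C.Nodup
  short_dummy : ∀ C ∈ s.short, 2 * n ∉ C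
  short_length : ∀ C ∈ s.short, C.length ≤ k
  count_le : s.todo.length + s.short.length ≤ B

end BranchState

/-! ### Scanning a clause for literals not assumed to be false -/

/-- One step of `scanClause`, on the number of literals still wanted, the literals assumed to be
false, the literals selected, and the overflow flag. -/
def scanStep (b : ℕ × List ℕ × List ℕ × Bool) (l : ℕ) : ℕ × List ℕ × List ℕ × Bool :=
  if l ∈ b.2.1 then b
  else if b.1 ≠ 0 then (b.1 - 1, l :: b.2.1, l :: b.2.2.1, b.2.2.2)
  else (b.1, b.2.1, b.2.2.1, true)

/-- Select up to `k` literals of the clause `C` that are not in `La`, and find out whether there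
are more. -/
def scanClause (k : ℕ) (La C : List ℕ) : ℕ × List ℕ × List ℕ × Bool :=
  C.foldl scanStep (k, La, [], false)

/-- The two cases of the flag are what branching needs: an overflow means that exactly `k` new
literals were selected, and no overflow means that every literal of the clause is selected or
already assumed false. -/
structure ScanSpec (k : ℕ) (La C : List ℕ) (b : ℕ × List ℕ × List ℕ × Bool) : Prop where
  count : b.2.2.1.length + b.1 = k
  falses_eq : b.2.1 = b.2.2.1 ++ La
  nodup : b.2.2.1.Nodup
  not_mem : ∀ l ∈ b.2.2.1, l ∉ La
  mem_clause : ∀ l ∈ b.2.2.1, l ∈ C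
  full : b.2.2.2 = true → b.1 = 0
  all : b.2.2.2 = false → ∀ l ∈ C, l ∈ b.2.1

theorem scanClause_spec (k : ℕ) (La C : List ℕ) : ScanSpec k La C (scanClause k La C) := by
  induction C using List.reverseRecOn with
  | nil => constructor <;> simp [scanClause]
  | append_singleton C l ih =>
    have h : scanClause k La (C ++ [l]) = scanStep (scanClause k La C) l := by
      simp [scanClause]
    rw [h]
    clear h
    generalize scanClause k La C = r at ih ⊢
    obtain ⟨c, F, S, b⟩ := r
    obtain ⟨h1, h2, h3, h4, h5, h6, h7⟩ := ih
    dsimp only at h1 h2 h3 h4 h5 h6 h7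
    simp only [scanStep]
    split_ifs with i1 i2
    · refine ⟨h1, h2, h3, h4, fun m hm => by simp [h5 m hm], h6, fun hb m hm => ?_⟩
      rcases List.mem_append.1 hm with hm | hm
      · exact h7 hb m hm
      · obtain rfl : m = l := by simpa using hm
        exact i1
    · have hl : l ∉ S ∧ l ∉ La := by simpa [h2] using i1
      constructor
      · simp; omega
      · simp [h2]
      · simp [hl.1, h3]
      · intro m hm
        rcases List.mem_cons.1 hm with rfl | hm
        exacts [hl.2, h4 m hm]
      · intro m hm
        rcases List.mem_cons.1 hm with rfl | hm
        · simp
        · simp [h5 m hm]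
      · intro hb
        exact absurd (h6 hb) i2
      · intro hb m hm
        rcases List.mem_append.1 hm with hm | hm
        · exact List.mem_cons_of_mem _ (h7 hb m hm)
        · simp_all
    · exact ⟨h1, h2, h3, h4, fun m hm => by simp [h5 m hm], fun _ => by simpa using i2,
        fun hb => by simp at hb⟩

namespace BranchState

/-- The child in which one of the selected literals is true. -/
def shorten (k : ℕ) (C : List ℕ) (rest : List (List ℕ)) (La : List ℕ) (S : List (List ℕ)) :
    BranchState :=
  ⟨rest, La, (scanClause k La C).2.2.1 :: S⟩

/-- The child in which all selected literals are false. -/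
def falsify (k : ℕ) (C : List ℕ) (rest : List (List ℕ)) (La : List ℕ) (S : List (List ℕ)) :
    BranchState :=
  ⟨C :: rest, (scanClause k La C).2.1, S⟩

/-- The children of the node with the clauses `C :: rest` to be treated. -/
def children (k : ℕ) (C : List ℕ) (rest : List (List ℕ)) (La : List ℕ) (S : List (List ℕ)) :
    List BranchState :=
  shorten k C rest La S ::
    if (scanClause k La C).2.2.2 = true then [falsify k C rest La S] else []

variable {n k B : ℕ} {C : List ℕ} {rest : List (List ℕ)} {La : List ℕ} {S : List (List ℕ)}

theorem Good.of_mem_children (h : Good n k B ⟨C :: rest, La, S⟩) {s : BranchState}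
    (hs : s ∈ children k C rest La S) : Good n k B s := by
  have hsc := scanClause_spec k La C
  have hlt : ∀ l ∈ (scanClause k La C).2.2.1, l < 2 * n + 2 := fun l hl =>
    h.todo_lt C (by simp) l (hsc.mem_clause l hl)
  rw [children, List.mem_cons] at hs
  rcases hs with rfl | hs
  · constructor
    · exact h.vars_le
    · exact h.width_le
    · exact h.falses_nodup
    · exact h.falses_lt
    · exact h.dummy_mem
    · exact fun D hD => h.todo_lt D (List.mem_cons_of_mem _ hD)
    · exact fun D hD => h.todo_length D (List.mem_cons_of_mem _ hD)
    · exact List.forall_mem_cons.2 ⟨hlt, h.short_lt⟩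
    · exact List.forall_mem_cons.2 ⟨hsc.nodup, h.short_nodup⟩
    · exact List.forall_mem_cons.2 ⟨fun hd => hsc.not_mem _ hd h.dummy_mem, h.short_dummy⟩
    · exact List.forall_mem_cons.2 ⟨by have := hsc.count; omega, h.short_length⟩
    · have := h.count_le
      simp only [shorten, List.length_cons] at this ⊢
      omega
  · split_ifs at hs
    · obtain rfl : s = falsify k C rest La S := by simpa using hs
      constructor
      · exact h.vars_le
      · exact h.width_le
      · simp only [falsify, hsc.falses_eq]
        exact List.nodup_append'.2 ⟨hsc.nodup, h.falses_nodup, hsc.not_mem⟩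
      · simp only [falsify, hsc.falses_eq]
        intro l hl
        rcases List.mem_append.1 hl with hl | hl
        exacts [hlt l hl, h.falses_lt l hl]
      · simp only [falsify, hsc.falses_eq]
        exact List.mem_append_right _ h.dummy_mem
      · exact h.todo_lt
      · exact h.todo_length
      · exact h.short_lt
      · exact h.short_nodup
      · exact h.short_dummy
      · exact h.short_length
      · exact h.count_le
    · simp at hs

/-- A satisfying assignment makes a selected literal true, which suits the first child, or makes all
of them false. In the latter case an overflow leads to the second child; without overflow the whole
clause would be false. Conversely, the selection is a part of the clause, and the second child only
adds assumptions. -/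
theorem sat_iff_children :
    Sat n ⟨C :: rest, La, S⟩ ↔ ∃ s ∈ children k C rest La S, Sat n s := by
  have hsc := scanClause_spec k La C
  constructor
  · rintro ⟨σ, h1, h2, h3, h4⟩
    have h3' : ∀ D ∈ rest, ∃ l ∈ D, σ l = true := fun D hD => h3 D (List.mem_cons_of_mem _ hD)
    by_cases ht : ∃ l ∈ (scanClause k La C).2.2.1, σ l = true
    · exact ⟨_, List.mem_cons_self, σ, h1, h2, h3', List.forall_mem_cons.2 ⟨ht, h4⟩⟩
    · push Not at ht
      have hF : ∀ l ∈ (scanClause k La C).2.1, σ l = false := by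
        intro l hl
        rw [hsc.falses_eq] at hl
        rcases List.mem_append.1 hl with hl | hl
        exacts [by simpa using ht l hl, h2 l hl]
      cases hb : (scanClause k La C).2.2.2
      · obtain ⟨l, hl, hl'⟩ := h3 C (by simp)
        rw [hF l (hsc.all hb l hl)] at hl'
        simp at hl'
      · exact ⟨falsify k C rest La S, by simp [children, hb], σ, h1, hF, h3, h4⟩
  · rintro ⟨s, hs, σ, h1, h2, h3, h4⟩
    rw [children, List.mem_cons] at hs
    rcases hs with rfl | hs
    · obtain ⟨⟨l, hl, hl'⟩, h5⟩ := List.forall_mem_cons.1 h4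
      exact ⟨σ, h1, h2, List.forall_mem_cons.2 ⟨⟨l, hsc.mem_clause l hl, hl'⟩, h3⟩, h5⟩
    · split_ifs at hs
      · obtain rfl : s = falsify k C rest La S := by simpa using hs
        refine ⟨σ, h1, fun l hl => h2 l ?_, h3, h4⟩
        simp only [falsify, hsc.falses_eq]
        exact List.mem_append_right _ hl
      · simp at hs

/-- A bound for the number of nodes below a node of the branching tree. -/
def weight (n k P : ℕ) (s : BranchState) : ℕ :=
  (s.todo.length + 1) * P ^ ((2 * n + 2 - s.falses.length) / k)

theorem length_falses_le {s : BranchState} (h : Good n k B s) :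
    s.falses.length ≤ 2 * n + 2 := by
  have : s.falses ⊆ List.range (2 * n + 2) := fun l hl => List.mem_range.2 (h.falses_lt l hl)
  simpa using (h.falses_nodup.subperm this).length_le

/-- With `r = rest.length` and `g` the exponent of the falsifying child, the shortening child uses
`r + 1` of the `r + 2` copies of `P ^ (g + 1)`. The last copy pays for the falsifying child and the
node itself, as `(r + 2) * P ^ g + 1 ≤ (r + 3) * P ^ g ≤ P ^ (g + 1)`. -/
theorem weight_children {P : ℕ} (h : Good n k B ⟨C :: rest, La, S⟩) (hk : 0 < k)
    (hP : rest.length + 3 ≤ P) :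
    ((children k C rest La S).map (weight n k P)).sum + 1 ≤ weight n k P ⟨C :: rest, La, S⟩ := by
  have hsc := scanClause_spec k La C
  have hpos : ∀ g, 1 ≤ P ^ g := fun g => Nat.one_le_pow _ _ (by omega)
  rw [children]
  split_ifs with hb
  · have hlen : (falsify k C rest La S).falses.length = k + La.length := by
      have := hsc.full hb
      have := hsc.count
      simp only [falsify, hsc.falses_eq, List.length_append]
      omega
    have hle := length_falses_le
      (h.of_mem_children (s := falsify k C rest La S) (by simp [children, hb]))
    obtain ⟨g, hg⟩ : ∃ g, g = (2 * n + 2 - (falsify k C rest La S).falses.length) / k := ⟨_, rfl⟩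
    -- The exponent drops by exactly one because `k` literals were added; `hle` keeps the truncated
    -- subtraction exact.
    have hg' : (2 * n + 2 - La.length) / k = g + 1 := by
      rw [hg, ← Nat.add_div_right _ hk]
      congr 1
      omega
    simp only [List.map_cons, List.map_nil, List.sum_cons, List.sum_nil, weight, ← hg]
    simp only [falsify, shorten, hg', List.length_cons, pow_succ]
    have := hpos g
    nlinarith
  · simp only [List.map_cons, List.map_nil, List.sum_cons, List.sum_nil, weight, shorten,
      List.length_cons]
    have := hpos ((2 * n + 2 - La.length) / k)
    nlinarith

end BranchState

/-! ## The constraint satisfaction problem of a leaf -/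

/-- All tuples of length `r` with at least one `true`. -/
def nonzeroTuples : ℕ → List (List Bool)
  | 0 => []
  | r + 1 => ((nonzeroTuples r).map (List.cons false)).reverse ++
      (((nonzeroTuples r).map (List.cons true)).reverse ++ [true :: List.replicate r false])

theorem mem_nonzeroTuples {r : ℕ} {a : List Bool} :
    a ∈ nonzeroTuples r ↔ a.length = r ∧ true ∈ a := by
  induction r generalizing a with
  | zero =>
    simp only [nonzeroTuples, List.not_mem_nil, false_iff, List.length_eq_zero_iff]
    rintro ⟨rfl, h⟩
    simp at h
  | succ r ih =>
    rcases a with _ | ⟨b, a⟩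
    · simp [nonzeroTuples]
    · cases b
      · simp [nonzeroTuples, ih]
      · simp only [nonzeroTuples, List.mem_append, List.mem_reverse, List.mem_map,
          List.cons.injEq, reduceCtorEq, false_and, and_false, exists_false, true_and,
          exists_eq_right, ih, List.length_cons, Nat.add_right_cancel_iff, List.mem_cons,
          List.not_mem_nil, or_false, true_or, and_true, false_or]
        constructor
        · rintro (h | rfl)
          · exact h.1
          · simp
        · rintro rfl
          by_cases h : true ∈ a
          · exact .inl ⟨rfl, h⟩
          · refine .inr (List.eq_replicate_iff.2 ⟨rfl, fun b hb => ?_⟩)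
            cases b
            · rfl
            · exact absurd hb h

theorem nodup_nonzeroTuples (r : ℕ) : (nonzeroTuples r).Nodup := by
  induction r with
  | zero => simp [nonzeroTuples]
  | succ r ih =>
    have hinj : ∀ b : Bool, Function.Injective (List.cons b) := fun b => List.cons_injective
    refine List.nodup_append'.2 ⟨List.nodup_reverse.2 (ih.map (hinj _)),
      List.nodup_append'.2 ⟨List.nodup_reverse.2 (ih.map (hinj _)), by simp, ?_⟩, ?_⟩
    · intro a h1 h2
      obtain rfl : a = true :: List.replicate r false := by simpa using h2
      simp [mem_nonzeroTuples] at h1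
    · intro a h1 h2
      obtain ⟨b, _, rfl⟩ : ∃ b, b ∈ nonzeroTuples r ∧ false :: b = a := by simpa using h1
      simp at h2

theorem length_nonzeroTuples (r : ℕ) : (nonzeroTuples r).length + 1 = 2 ^ r := by
  induction r with
  | zero => rfl
  | succ r ih => simp [nonzeroTuples, pow_succ]; omega

/-- The constraints `x ≠ y` for the first `m` pairs of complementary literals. -/
def pairConstraints : ℕ → List (List ℕ × List (List Bool))
  | 0 => []
  | m + 1 => ([2 * m, 2 * m + 1], [[false, true], [true, false]]) :: pairConstraints m

theorem mem_pairConstraints {m : ℕ} {c : List ℕ × List (List Bool)} :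
    c ∈ pairConstraints m ↔
      ∃ x < m, c = ([2 * x, 2 * x + 1], [[false, true], [true, false]]) := by
  induction m with
  | zero => simp [pairConstraints]
  | succ m ih =>
    simp only [pairConstraints, List.mem_cons, ih]
    constructor
    · rintro (rfl | ⟨x, hx, rfl⟩)
      exacts [⟨m, by omega, rfl⟩, ⟨x, by omega, rfl⟩]
    · rintro ⟨x, hx, rfl⟩
      rcases Nat.lt_succ_iff_lt_or_eq.1 hx with hx | rfl
      exacts [.inr ⟨x, hx, rfl⟩, .inl rfl]

/-- The false literal `2 * n` is put in front of every clause so that an empty clause also has a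
nonempty scope; its relation then demands that `2 * n` be true, as it should. -/
def leafConstraints (n : ℕ) (La : List ℕ) (S : List (List ℕ)) :
    List (List ℕ × List (List Bool)) :=
  (S.map fun C => (2 * n :: C, nonzeroTuples (C.length + 1))).reverse ++
    ((La.map fun l => ([l], [[false]])).reverse ++ pairConstraints (n + 1))

theorem mem_leafConstraints {n : ℕ} {La : List ℕ} {S : List (List ℕ)}
    {c : List ℕ × List (List Bool)} :
    c ∈ leafConstraints n La S ↔
      (∃ C ∈ S, c = (2 * n :: C, nonzeroTuples (C.length + 1))) ∨
      (∃ l ∈ La, c = ([l], [[false]])) ∨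
      ∃ x < n + 1, c = ([2 * x, 2 * x + 1], [[false, true], [true, false]]) := by
  simp [leafConstraints, mem_pairConstraints, eq_comm]

structure ValidConstraint (m : ℕ) (c : List ℕ × List (List Bool)) : Prop where
  ne_nil : c.1 ≠ []
  nodup : c.1.Nodup
  lt : ∀ v ∈ c.1, v < m
  rel_nodup : c.2.Nodup
  rel_length : ∀ a ∈ c.2, a.length = c.1.length

def ValidConstraint.toBoolConstraint {m : ℕ} (c : List ℕ × List (List Bool))
    (h : ValidConstraint m c) : BoolConstraint m where
  scope := c.1.pmap Fin.mk h.lt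
  rel := c.2
  scope_ne_nil := by simpa using h.ne_nil
  scope_nodup := h.nodup.pmap fun a ha b hb hab => by simpa using hab
  rel_nodup := h.rel_nodup
  rel_length := by simpa using h.rel_length

theorem BranchState.Good.validConstraint {n k B : ℕ} {s : BranchState} (h : s.Good n k B) :
    ∀ c ∈ leafConstraints n s.falses s.short, ValidConstraint (2 * n + 2) c := by
  intro c hc
  rcases mem_leafConstraints.1 hc with ⟨C, hC, rfl⟩ | ⟨l, hl, rfl⟩ | ⟨x, hx, rfl⟩
  · constructor
    · simp
    · exact List.nodup_cons.2 ⟨h.short_dummy C hC, h.short_nodup C hC⟩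
    · exact List.forall_mem_cons.2 ⟨by omega, h.short_lt C hC⟩
    · exact nodup_nonzeroTuples _
    · intro a ha
      simpa using (mem_nonzeroTuples.1 ha).1
  · constructor <;> simp [h.falses_lt l hl]
  · constructor
    · simp
    · simp
    · simp; omega
    · simp
    · simp

/-- The disequality constraints secure both side conditions on instances: they cover all variables
and contain both values. Because of the dummy variable there is such a constraint even for `n = 0`.
-/
def BranchState.Good.csp {n k B : ℕ} {s : BranchState} (h : s.Good n k B) : BoolCSP where
  numVars := 2 * n + 2
  constraints := (leafConstraints n s.falses s.short).pmap
    ValidConstraint.toBoolConstraint h.validConstraint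
  var_occurs := by
    intro v
    refine ⟨_, List.mem_pmap.2 ⟨_, mem_leafConstraints.2 (.inr (.inr ⟨v / 2, by omega, rfl⟩)),
      rfl⟩, ?_⟩
    simp only [ValidConstraint.toBoolConstraint, List.mem_pmap, List.mem_cons, List.not_mem_nil,
      or_false]
    exact ⟨v, by omega, rfl⟩
  value_occurs := by
    intro b
    refine ⟨_, List.mem_pmap.2 ⟨_, mem_leafConstraints.2 (.inr (.inr ⟨0, by omega, rfl⟩)), rfl⟩,
      [false, true], by simp [ValidConstraint.toBoolConstraint], by cases b <;> simp⟩

/-- The disequalities say that the assignment respects complements, and the unary constraints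
enforce the false literals, among them `2 * n`. Hence a tuple on `2 * n :: C` contains `true`
exactly if some literal of `C` is true. -/
theorem BranchState.Good.consistent_csp_iff {n k B : ℕ} {La : List ℕ} {S : List (List ℕ)}
    (h : Good n k B ⟨[], La, S⟩) : h.csp.Consistent ↔ Sat n ⟨[], La, S⟩ := by
  have key : ∀ τ : Fin (2 * n + 2) → Bool, ∀ σ : ℕ → Bool, (∀ v, τ v = σ v) →
      ((∀ c ∈ h.csp.constraints, c.scope.map τ ∈ c.rel) ↔
        ∀ c ∈ leafConstraints n La S, c.1.map σ ∈ c.2) := by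
    intro τ σ hτ
    have hmap : ∀ (L : List ℕ) (hL : ∀ v ∈ L, v < 2 * n + 2),
        (L.pmap Fin.mk hL).map τ = L.map σ := by
      intro L hL
      rw [List.map_pmap]
      simp only [hτ]
      exact List.pmap_eq_map ..
    constructor
    · intro hc c hc'
      have := hc _ (List.mem_pmap.2 ⟨c, hc', rfl⟩)
      simpa only [ValidConstraint.toBoolConstraint, hmap] using this
    · intro hc d hd
      obtain ⟨c, hc', rfl⟩ := List.mem_pmap.1 hd
      simpa only [ValidConstraint.toBoolConstraint, hmap] using hc c hc'
  have sat : ∀ σ : ℕ → Bool, (∀ c ∈ leafConstraints n La S, c.1.map σ ∈ c.2) ↔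
      IsLiteralAssignment n σ ∧ (∀ l ∈ La, σ l = false) ∧ ∀ C ∈ S, ∃ l ∈ C, σ l = true := by
    intro σ
    have hS : σ (2 * n) = false → ∀ C, ((2 * n :: C).map σ ∈ nonzeroTuples (C.length + 1) ↔
        ∃ l ∈ C, σ l = true) := by
      intro h0 C
      simp [mem_nonzeroTuples, h0]
    constructor
    · intro hc
      have hLa : ∀ l ∈ La, σ l = false := fun l hl => by
        simpa using hc _ (mem_leafConstraints.2 (.inr (.inl ⟨l, hl, rfl⟩)))
      refine ⟨fun x hx => ?_, hLa, fun C hC => ?_⟩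
      · have := hc _ (mem_leafConstraints.2 (.inr (.inr ⟨x, by omega, rfl⟩)))
        simp only [List.map_cons, List.map_nil, List.mem_cons, List.cons.injEq, and_true,
          List.not_mem_nil, or_false] at this
        rcases this with ⟨h1, h2⟩ | ⟨h1, h2⟩ <;> simp [h1, h2]
      · exact (hS (hLa _ h.dummy_mem) C).1 (hc _ (mem_leafConstraints.2 (.inl ⟨C, hC, rfl⟩)))
    · rintro ⟨h1, h2, h3⟩ c hc
      rcases mem_leafConstraints.1 hc with ⟨C, hC, rfl⟩ | ⟨l, hl, rfl⟩ | ⟨x, hx, rfl⟩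
      · exact (hS (h2 _ h.dummy_mem) C).2 (h3 C hC)
      · simp [h2 l hl]
      · simp only [List.map_cons, List.map_nil, List.mem_cons, List.cons.injEq, and_true,
          List.not_mem_nil, or_false, h1 x (by omega)]
        cases σ (2 * x) <;> simp
  constructor
  · rintro ⟨τ, hτ⟩
    let σ : ℕ → Bool := fun v => if hv : v < 2 * n + 2 then τ ⟨v, hv⟩ else false
    obtain ⟨h1, h2, h3⟩ := (sat σ).1 ((key τ σ fun v => by simp only [σ, v.2, dite_true]; rfl).1 hτ)
    exact ⟨σ, h1, h2, by simp, h3⟩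
  · rintro ⟨σ, h1, h2, -, h3⟩
    exact ⟨fun v => σ v, (key _ σ fun _ => rfl).2 ((sat σ).2 ⟨h1, h2, h3⟩)⟩

theorem BranchState.Good.length_le {n k B : ℕ} {s : BranchState} (h : s.Good n k B) :
    (leafConstraints n s.falses s.short).length ≤ 3 * B := by
  have hpair : ∀ m, (pairConstraints m).length = m := by
    intro m
    induction m with
    | zero => rfl
    | succ m ih => simp [pairConstraints, ih]
  have h1 := length_falses_le h
  have h2 := h.count_le
  have h3 := h.vars_le
  simp only [leafConstraints, List.length_append, List.length_reverse, List.length_map, hpair]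
  omega

/-- There are at most `3 * B` constraints, each with scope and relation of length at most `B`. For
the clauses this uses that a relation has fewer than `2 ^ (k + 1)` tuples. -/
theorem BranchState.Good.size_csp_le {n k B : ℕ} {s : BranchState} (h : s.Good n k B) :
    h.csp.size ≤ 3 * B ^ 3 := by
  have hB : 2 ≤ B := by have := h.vars_le; omega
  have hk : k + 1 < B := lt_of_lt_of_le Nat.lt_two_pow_self h.width_le
  have hc : ∀ c ∈ leafConstraints n s.falses s.short, c.1.length * c.2.length ≤ B * B := by
    intro c hc
    rcases mem_leafConstraints.1 hc with ⟨C, hC, rfl⟩ | ⟨l, hl, rfl⟩ | ⟨x, hx, rfl⟩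
    · have h1 := h.short_length C hC
      refine Nat.mul_le_mul (by simp; omega) ?_
      have h2 := length_nonzeroTuples (C.length + 1)
      have h3 : 2 ^ (C.length + 1) ≤ 2 ^ (k + 1) := Nat.pow_le_pow_right (by omega) (by omega)
      have h4 := h.width_le
      show (nonzeroTuples (C.length + 1)).length ≤ B
      omega
    · simp; nlinarith
    · simp; nlinarith
  have hsize : h.csp.size =
      ((leafConstraints n s.falses s.short).map fun c => c.1.length * c.2.length).sum := by
    simp only [BoolCSP.size, csp, List.map_pmap, ValidConstraint.toBoolConstraint,
      List.length_pmap]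
    congr 1
    exact List.pmap_eq_map ..
  rw [hsize]
  refine (List.sum_le_card_nsmul _ (B * B) ?_).trans ?_
  · intro m hm
    obtain ⟨c, hc', rfl⟩ := List.mem_map.1 hm
    exact hc c hc'
  · rw [List.length_map, smul_eq_mul]
    calc _ ≤ 3 * B * (B * B) := Nat.mul_le_mul_right _ h.length_le
      _ = 3 * B ^ 3 := by ring

/-! ## Programs for the branching step and for the leaves -/

def encodeScan (b : ℕ × List ℕ × List ℕ × Bool) : BinTree :=
  .node (.ofNat b.1) (.node (.ofList .ofNat b.2.1) (.node (.ofList .ofNat b.2.2.1)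
    (.ofBool b.2.2.2)))

def BranchState.encode (s : BranchState) : BinTree :=
  .node (.ofList (.ofList .ofNat) s.todo)
    (.node (.ofList .ofNat s.falses) (.ofList (.ofList .ofNat) s.short))

def encodeConstraint (c : List ℕ × List (List Bool)) : BinTree :=
  .node (.ofList .ofNat c.1) (.ofList (.ofList .ofBool) c.2)

namespace PolyMap

variable {ι : Type} {N : ι → ℕ} {e : ι → BinTree}

theorem scan_step {r : ι → ℕ × List ℕ × List ℕ × Bool} {l : ι → ℕ}
    (hr : PolyMap N e (fun i => encodeScan (r i))) (hl : PolyMap N e (fun i => .ofNat (l i)))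
    (hN : ∀ i, l i ≤ N i) (hlen : ∀ i, (r i).2.1.length ≤ N i)
    (hN' : ∀ i, ∀ m ∈ (r i).2.1, m ≤ N i) :
    PolyMap N e (fun i => encodeScan (scanStep (r i) (l i))) := by
  have h1 : PolyMap N e (fun i => .ofNat (r i).1) := hr.left
  have h2 : PolyMap N e (fun i => .ofList .ofNat (r i).2.1) := hr.right.left
  have h3 : PolyMap N e (fun i => .ofList .ofNat (r i).2.2.1) := hr.right.right.left
  have h4 : PolyMap N e (fun i => .ofBool (r i).2.2.2) := hr.right.right.right
  refine (ite (mem hl h2 hN hlen hN') hr (ite_ne_zero h1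
    (h1.pred.node ((listCons hl h2).node ((listCons hl h3).node h4)))
    (h1.node (h2.node (h3.node (const (.ofBool true))))))).congr (fun _ => rfl) fun i => ?_
  unfold scanStep
  split_ifs <;> rfl

theorem scan {k : ι → ℕ} {La C : ι → List ℕ} (hk : PolyMap N e (fun i => .ofNat (k i)))
    (hLa : PolyMap N e (fun i => .ofList .ofNat (La i)))
    (hC : PolyMap N e (fun i => .ofList .ofNat (C i)))
    (hlen : ∀ i, (C i).length + (La i).length ≤ N i) (hNC : ∀ i, ∀ l ∈ C i, l ≤ N i)
    (hNL : ∀ i, ∀ l ∈ La i, l ≤ N i) :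
    PolyMap N e (fun i => encodeScan (scanClause (k i) (La i) (C i))) := by
  refine foldl (encβ := encodeScan) (init := fun i => (k i, La i, [], false))
    (step := fun _ => scanStep) (fun i => (Nat.le_add_right _ _).trans (hlen i)) hC
    (hk.node (hLa.node (listNil.node (const (.ofBool false))))) ?_
  intro κ π pre l suf hl
  have hsc : ∀ j, ScanSpec (k (π j)) (La (π j)) (pre j)
    (scanClause (k (π j)) (La (π j)) (pre j)) := fun j => scanClause_spec _ _ _
  have hpre : ∀ j, ∀ m ∈ pre j, m ∈ C (π j) := fun j m hm => by simp [hl j, hm]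
  refine scan_step (r := fun j => scanClause (k (π j)) (La (π j)) (pre j)) (.left (.left .id))
    (.right (.left .id)) (fun j => hNC _ _ (by simp [hl j])) (fun j => ?_) fun j m hm => ?_
  · have h1 : (scanClause (k (π j)) (La (π j)) (pre j)).2.2.1.length ≤ (pre j).length :=
      ((hsc j).nodup.subperm (hsc j).mem_clause).length_le
    have h2 := hlen (π j)
    rw [hl j, List.length_append] at h2
    rw [(hsc j).falses_eq, List.length_append]
    omega
  · rw [(hsc j).falses_eq, List.mem_append] at hm
    rcases hm with hm | hm
    exacts [hNC _ _ (hpre j m ((hsc j).mem_clause m hm)), hNL _ _ hm]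

theorem children {k : ι → ℕ} {La C : ι → List ℕ} {rest S : ι → List (List ℕ)}
    {st : ι → List BranchState} (hk : PolyMap N e (fun i => .ofNat (k i)))
    (hC : PolyMap N e (fun i => .ofList .ofNat (C i)))
    (hrest : PolyMap N e (fun i => .ofList (.ofList .ofNat) (rest i)))
    (hLa : PolyMap N e (fun i => .ofList .ofNat (La i)))
    (hS : PolyMap N e (fun i => .ofList (.ofList .ofNat) (S i)))
    (hst : PolyMap N e (fun i => .ofList BranchState.encode (st i)))
    (hlen : ∀ i, (C i).length + (La i).length ≤ N i) (hNC : ∀ i, ∀ l ∈ C i, l ≤ N i)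
    (hNL : ∀ i, ∀ l ∈ La i, l ≤ N i) :
    PolyMap N e (fun i => .ofList BranchState.encode
      (BranchState.children (k i) (C i) (rest i) (La i) (S i) ++ st i)) := by
  have hr := scan hk hLa hC hlen hNC hNL
  have h2 : PolyMap N e (fun i => .ofList .ofNat (scanClause (k i) (La i) (C i)).2.1) :=
    hr.right.left
  have h3 : PolyMap N e (fun i => .ofList .ofNat (scanClause (k i) (La i) (C i)).2.2.1) :=
    hr.right.right.left
  have h4 : PolyMap N e (fun i => .ofBool (scanClause (k i) (La i) (C i)).2.2.2) :=
    hr.right.right.right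
  have h5 : PolyMap N e (fun i => BranchState.encode
      (BranchState.shorten (k i) (C i) (rest i) (La i) (S i))) :=
    hrest.node (hLa.node (listCons h3 hS))
  have h6 : PolyMap N e (fun i => BranchState.encode
      (BranchState.falsify (k i) (C i) (rest i) (La i) (S i))) :=
    (listCons hC hrest).node (h2.node hS)
  refine (listCons h5 (L := fun i => if (scanClause (k i) (La i) (C i)).2.2.2 = true then
    BranchState.falsify (k i) (C i) (rest i) (La i) (S i) :: st i else st i)
    ((ite (P := fun i => (scanClause (k i) (La i) (C i)).2.2.2 = true)
      (h4.congr (fun _ => rfl) fun i => by simp) (listCons h6 hst) hst).congr (fun _ => rfl)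
      fun i => ?_)).congr (fun _ => rfl) fun i => ?_
  · split_ifs <;> rfl
  · unfold BranchState.children
    split_ifs <;> rfl

theorem nonzeroTuples_succ {r : ι → ℕ}
    (hz : PolyMap N e (fun i => .ofList .ofBool (List.replicate (r i) false)))
    (ht : PolyMap N e (fun i => .ofList (.ofList .ofBool) (nonzeroTuples (r i))))
    (hlen : ∀ i, (nonzeroTuples (r i)).length ≤ N i) :
    PolyMap N e (fun i => .ofList (.ofList .ofBool) (nonzeroTuples (r i + 1))) := by
  have hcons : ∀ (b : Bool) (κ : Type) (π : κ → ι) (a : κ → List Bool),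
      PolyMap (fun j => N (π j)) (fun j => .node (.ofList .ofBool (a j)) (e (π j)))
        (fun j => .ofList .ofBool (b :: a j)) := fun b κ π a =>
    listCons (a := fun _ => b) (const (.ofBool b)) (.left .id)
  exact mapOnto (φ := fun _ => List.cons false) hlen ht
    (mapOnto (φ := fun _ => List.cons true) hlen ht
      (listCons (listCons (a := fun _ => true) (const (.ofBool true)) hz) listNil)
      fun κ π a _ => hcons true κ π a)
    fun κ π a _ => hcons false κ π a

/-- The relation is built while walking along the clause, together with the all-false tuple that the
recursion needs. The count starts at `1` for the dummy literal, and the bound on the final table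
covers all intermediate ones. -/
theorem nonzeroTuples_length {C : ι → List ℕ}
    (hC : PolyMap N e (fun i => .ofList .ofNat (C i)))
    (hN : ∀ i, 2 ^ ((C i).length + 1) ≤ N i) :
    PolyMap N e (fun i => .ofList (.ofList .ofBool) (nonzeroTuples ((C i).length + 1))) := by
  have hcount : ∀ L : List ℕ, L.foldl (fun r _ => r + 1) 1 = L.length + 1 := fun L => by
    induction L using List.reverseRecOn <;> simp_all
  have := foldl (L := C) (e := e) (N := N) (enc := .ofNat)
    (encβ := fun r => .node (.ofList .ofBool (List.replicate r false))
      (.ofList (.ofList .ofBool) (nonzeroTuples r)))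
    (init := fun _ => 1) (step := fun _ r _ => r + 1)
    (fun i => (Nat.lt_two_pow_self.le.trans
      (Nat.pow_le_pow_right (by omega) (Nat.le_succ _))).trans (hN i)) hC (const _) ?_
  · exact this.right.congr (fun _ => rfl) fun i => by rw [hcount]
  · intro κ π pre l suf hl
    refine PolyMap.node (listCons (a := fun _ => false) (const (.ofBool false))
      (.left (.left (.left .id)))) (nonzeroTuples_succ (.left (.left (.left .id)))
      (.right (.left (.left .id))) fun j => ?_)
    rw [hcount]
    have h1 := length_nonzeroTuples ((pre j).length + 1)
    have h2 : 2 ^ ((pre j).length + 1) ≤ 2 ^ ((C (π j)).length + 1) :=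
      Nat.pow_le_pow_right (by omega) (by simp [hl j])
    have h3 := hN (π j)
    omega

theorem pairConstraints {n : ι → ℕ} (hn : PolyMap N e (fun i => .ofNat (n i)))
    (hN : ∀ i, n i ≤ N i) :
    PolyMap N e (fun i => .ofList encodeConstraint (pairConstraints (n i))) := by
  have := iter (s := fun _ j => .node (.ofNat (2 * j))
    (.ofList encodeConstraint (_root_.pairConstraints j))) hN hn (const _) fun κ π j _ => by
      have h1 : PolyMap (fun a => N (π a)) (fun a => .node (.node (.ofNat (2 * j a))
          (.ofList encodeConstraint (_root_.pairConstraints (j a)))) (e (π a)))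
          (fun a => .ofNat (2 * j a)) := .left (.left .id)
      exact (h1.addConst 2).node (listCons (a := fun a => ([2 * j a, 2 * j a + 1],
        [[false, true], [true, false]]))
        ((listCons h1 (listCons h1.succ listNil)).node (const _)) (.right (.left .id)))
  exact this.right

theorem leafConstraints {n : ι → ℕ} {La : ι → List ℕ} {S : ι → List (List ℕ)}
    (hn : PolyMap N e (fun i => .ofNat (n i)))
    (hLa : PolyMap N e (fun i => .ofList .ofNat (La i)))
    (hS : PolyMap N e (fun i => .ofList (.ofList .ofNat) (S i)))
    (hNn : ∀ i, n i + 1 ≤ N i) (hNL : ∀ i, (La i).length ≤ N i) (hNS : ∀ i, (S i).length ≤ N i)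
    (hNC : ∀ i, ∀ C ∈ S i, 2 ^ (C.length + 1) ≤ N i) :
    PolyMap N e (fun i => .ofList encodeConstraint (leafConstraints (n i) (La i) (S i))) := by
  refine mapOnto (φ := fun i C => (2 * n i :: C, nonzeroTuples (C.length + 1))) hNS hS
    (mapOnto (φ := fun _ l => ([l], [[false]])) hNL hLa
      (PolyMap.pairConstraints hn.succ hNn) ?_) ?_
  · intro κ π l _
    exact (listCons (.left .id) listNil).node (const _)
  · intro κ π C hC
    have hn' := (hn.double fun i => by have := hNn i; omega).lift π
      (fun j => .ofList .ofNat (C j))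
    exact (listCons hn' (.left .id)).node
      (nonzeroTuples_length (.left .id) fun j => hNC _ _ (hC j))

end PolyMap

/-! ### Agreement of the instance encoding with the computed tree -/

theorem BinTree.ofList_map {α β : Type} (enc : β → BinTree) (φ : α → β) (L : List α) :
    BinTree.ofList enc (L.map φ) = BinTree.ofList (fun a => enc (φ a)) L := by
  induction L with
  | nil => rfl
  | cons a L ih => simp [ofList, ih]

theorem BinTree.ofList_pmap {α β : Type} {P : α → Prop} {enc : β → BinTree} {enc' : α → BinTree}
    {φ : ∀ a, P a → β} (h : ∀ a ha, enc (φ a ha) = enc' a) (L : List α) (hL : ∀ a ∈ L, P a) :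
    BinTree.ofList enc (L.pmap φ hL) = BinTree.ofList enc' L := by
  induction L with
  | nil => rfl
  | cons a L ih => simp [ofList, h, ih]

theorem BranchState.Good.encode_csp {n k B : ℕ} {s : BranchState} (h : s.Good n k B) :
    h.csp.encode = .node (.ofNat (2 * n + 2))
      (.ofList encodeConstraint (leafConstraints n s.falses s.short)) := by
  refine congrArg _ (BinTree.ofList_pmap (fun c hc => ?_) _ _)
  exact congrArg₂ _ (BinTree.ofList_pmap (φ := Fin.mk) (fun _ _ => rfl) _ _) rfl

/-! ## Depth-first search through the branching tree -/

/-- The configuration of the search: the parameters, the answer found so far, and the stack. -/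
def searchTree (n k : ℕ) (acc : BinTree) (st : List BranchState) : BinTree :=
  .node (.node (.ofNat n) (.ofNat k)) (.node acc (.ofList BranchState.encode st))

/-- The bound `B` is part of the index though it is not stored in the configuration: the program is
the same for all bounds, and `B` only measures its running time. -/
structure StepIndex where
  (n k B : ℕ)
  acc : BinTree
  C : List ℕ
  rest : List (List ℕ)
  La : List ℕ
  S : List (List ℕ)
  st : List BranchState
  good : BranchState.Good n k B ⟨C :: rest, La, S⟩

theorem polyMap_step : PolyMap (fun x : StepIndex => 2 * x.B)
    (fun x => searchTree x.n x.k x.acc (⟨x.C :: x.rest, x.La, x.S⟩ :: x.st))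
    (fun x => searchTree x.n x.k x.acc (BranchState.children x.k x.C x.rest x.La x.S ++ x.st)) := by
  have hid : PolyMap (fun x : StepIndex => 2 * x.B)
    (fun x => searchTree x.n x.k x.acc (⟨x.C :: x.rest, x.La, x.S⟩ :: x.st))
    (fun x => searchTree x.n x.k x.acc (⟨x.C :: x.rest, x.La, x.S⟩ :: x.st)) := .id
  refine hid.left.node (hid.right.left.node (.children hid.left.right
    hid.right.right.left.left.left hid.right.right.left.left.right
    hid.right.right.left.right.left hid.right.right.left.right.right hid.right.right.right
    (fun x => ?_) (fun x l hl => ?_) fun x l hl => ?_))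
  · have h1 := BranchState.length_falses_le x.good
    have h2 := x.good.todo_length x.C (by simp)
    have h3 := x.good.vars_le
    simp only at h1
    omega
  · have h1 := x.good.todo_lt x.C (by simp) l hl
    have h3 := x.good.vars_le
    omega
  · have h1 := x.good.falses_lt l hl
    have h3 := x.good.vars_le
    omega

structure LeafIndex where
  (n k B : ℕ)
  acc : BinTree
  La : List ℕ
  S : List (List ℕ)
  st : List BranchState
  good : BranchState.Good n k B ⟨[], La, S⟩

theorem polyMap_leaf : PolyMap (fun x : LeafIndex => 2 * x.B)
    (fun x => searchTree x.n x.k x.acc (⟨[], x.La, x.S⟩ :: x.st))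
    (fun x => x.good.csp.encode) := by
  have hid : PolyMap (fun x : LeafIndex => 2 * x.B)
    (fun x => searchTree x.n x.k x.acc (⟨[], x.La, x.S⟩ :: x.st))
    (fun x => searchTree x.n x.k x.acc (⟨[], x.La, x.S⟩ :: x.st)) := .id
  have hn : PolyMap (fun x : LeafIndex => 2 * x.B)
    (fun x => searchTree x.n x.k x.acc (⟨[], x.La, x.S⟩ :: x.st)) (fun x => .ofNat x.n) :=
    hid.left.left
  refine (((hn.double fun x => ?_).addConst 2).node (.leafConstraints hn
    hid.right.right.left.right.left hid.right.right.left.right.right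
    (fun x => ?_) (fun x => ?_) (fun x => ?_) fun x C hC => ?_)).congr (fun _ => rfl)
    fun x => x.good.encode_csp.symm
  · have := x.good.vars_le
    omega
  · have := x.good.vars_le
    omega
  · have h1 := BranchState.length_falses_le x.good
    have h3 := x.good.vars_le
    show x.La.length ≤ _
    simp only at h1
    omega
  · have := x.good.count_le
    simp only [List.length_nil] at this
    show x.S.length ≤ _
    omega
  · have h1 := x.good.width_le
    have h2 : 2 ^ (C.length + 1) ≤ 2 ^ (x.k + 1) :=
      Nat.pow_le_pow_right (by omega) (Nat.succ_le_succ (x.good.short_length C hC))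
    omega

theorem WhileProg.Runs.pair_empty (x : BinTree) :
    (WhileProg.pair .empty .empty).Runs x (.node .nil .nil) 3 :=
  .pair (.empty x) (.empty x)

/-- One round of the search, with a program `A` for Boolean CSP. -/
theorem exists_search_round {A : WhileProg} {TA : BoolCSP → ℕ}
    (hA : ∀ I : BoolCSP, ∃ out t, A.Runs I.encode out t ∧ (out ≠ .nil ↔ I.Consistent) ∧
      t ≤ TA I) :
    ∃ (body : WhileProg) (c : ℕ), ∀ (n k B T P : ℕ) (acc : BinTree) (s : BranchState)
      (st : List BranchState), 0 < k → ∀ h : s.Good n k B, TA h.csp ≤ T →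
      s.todo.length + 2 ≤ P →
      ∃ acc' new t, body.Runs (searchTree n k acc (s :: st)) (searchTree n k acc' (new ++ st)) t ∧
        t ≤ (B + 2) ^ c + T ∧
        (∀ s' ∈ new, s'.Good n k B ∧ s'.todo.length + 2 ≤ P) ∧
        ((acc' ≠ .nil ∨ ∃ s' ∈ new, s'.Sat n) ↔ acc ≠ .nil ∨ s.Sat n) ∧
        (new.map (BranchState.weight n k P)).sum + 1 ≤ s.weight n k P := by
  obtain ⟨p, a, hp⟩ := polyMap_step.mono (N' := fun x => x.B) 2
    fun x => by nlinarith
  obtain ⟨q, b, hq⟩ := polyMap_leaf.mono (N' := fun x => x.B) 2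
    fun x => by nlinarith
  -- The test reads the pending clauses of the top state. If there are any, the state is replaced by
  -- its children; otherwise its CSP is built and given to `A`, the state is popped, and the answer
  -- is set or kept.
  refine ⟨.branch (.seq .right (.seq .right (.seq .left .left))) p
    (.pair .left (.pair (.branch (.seq q A) (.pair .empty .empty) (.seq .right .left))
      (.seq .right (.seq .right .right)))), a + b + 6, ?_⟩
  rintro n k B T P acc ⟨todo, La, S⟩ st hk h hT hP
  have hB : 2 ≤ B + 2 := by omega
  have hpow : (B + 2) ^ a + (B + 2) ^ b + 30 ≤ (B + 2) ^ (a + b + 6) := by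
    have h1 : (B + 2) ^ a ≤ (B + 2) ^ (a + b) := Nat.pow_le_pow_right (by omega) (by omega)
    have h2 : (B + 2) ^ b ≤ (B + 2) ^ (a + b) := Nat.pow_le_pow_right (by omega) (by omega)
    have h3 : 1 ≤ (B + 2) ^ (a + b) := Nat.one_le_pow _ _ (by omega)
    have h4 : 2 ^ 6 ≤ (B + 2) ^ 6 := Nat.pow_le_pow_left hB 6
    rw [pow_add (B + 2) (a + b) 6]
    nlinarith
  have htest : (WhileProg.seq .right (.seq .right (.seq .left .left))).Runs
      (searchTree n k acc (⟨todo, La, S⟩ :: st)) (.ofList (.ofList .ofNat) todo) 7 :=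
    .seq (.right _) (.seq (.right _) (.seq (.left _) (.left _)))
  rcases todo with _ | ⟨C, rest⟩
  · obtain ⟨t1, h1, h1'⟩ := hq ⟨n, k, B, acc, La, S, st, h⟩
    obtain ⟨out, t2, h2, h2', h2''⟩ := hA h.csp
    have hrest : (WhileProg.seq .right (.seq .right .right)).Runs
        (searchTree n k acc (⟨[], La, S⟩ :: st)) (.ofList BranchState.encode st) 5 :=
      .seq (.right _) (.seq (.right _) (.right _))
    have hacc : (WhileProg.seq .right .left).Runs
        (searchTree n k acc (⟨[], La, S⟩ :: st)) acc 3 :=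
      .seq (.right _) (.left _)
    rw [h.consistent_csp_iff] at h2'
    have hw : (([] : List BranchState).map (BranchState.weight n k P)).sum + 1 ≤
        BranchState.weight n k P ⟨[], La, S⟩ := by
      simp only [BranchState.weight, List.map_nil, List.sum_nil, List.length_nil]
      have := Nat.one_le_pow ((2 * n + 2 - La.length) / k) P (by omega)
      omega
    simp only at h1'
    rcases out with _ | ⟨u, v⟩
    · refine ⟨acc, [], _, .branch_false htest (.pair (.left _)
        (.pair (.branch_false (.seq h1 h2) hacc) hrest)), by omega, by simp, ?_, hw⟩
      have : ¬ BranchState.Sat n ⟨[], La, S⟩ := fun hs => h2'.2 hs rfl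
      simp [this]
    · refine ⟨.node .nil .nil, [], _, .branch_false htest (.pair (.left _)
        (.pair (.branch_true (.seq h1 h2) (.pair_empty _)) hrest)), by omega, by simp,
        ?_, hw⟩
      have : BranchState.Sat n ⟨[], La, S⟩ := h2'.1 (by simp)
      simp [this]
  · obtain ⟨t1, h1, h1'⟩ := hp ⟨n, k, B, acc, C, rest, La, S, st, h⟩
    simp only at h1'
    refine ⟨acc, BranchState.children k C rest La S, _, .branch_true htest h1, by omega,
      fun s' hs' => ⟨h.of_mem_children hs', ?_⟩, ?_, BranchState.weight_children h hk hP⟩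
    · rw [BranchState.children, List.mem_cons] at hs'
      simp only [List.length_cons] at hP
      rcases hs' with rfl | hs'
      · simp only [BranchState.shorten]
        omega
      · split_ifs at hs'
        · obtain rfl := List.mem_singleton.1 hs'
          simp only [BranchState.falsify, List.length_cons]
          omega
        · simp at hs'
    · rw [← BranchState.sat_iff_children]

/-- The whole search. -/
theorem exists_search {A : WhileProg} {TA : BoolCSP → ℕ}
    (hA : ∀ I : BoolCSP, ∃ out t, A.Runs I.encode out t ∧ (out ≠ .nil ↔ I.Consistent) ∧
      t ≤ TA I) :
    ∃ (p : WhileProg) (c : ℕ), ∀ (n k B T P : ℕ), 0 < k →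
      (∀ (s : BranchState) (h : s.Good n k B), TA h.csp ≤ T) →
      ∀ (W : ℕ) (acc : BinTree) (st : List BranchState),
      (∀ s ∈ st, s.Good n k B ∧ s.todo.length + 2 ≤ P) →
      (st.map (BranchState.weight n k P)).sum ≤ W →
      ∃ acc' t, p.Runs (searchTree n k acc st) (searchTree n k acc' []) t ∧
        t ≤ W * ((B + 2) ^ c + T + 4) + 4 ∧ (acc' ≠ .nil ↔ acc ≠ .nil ∨ ∃ s ∈ st, s.Sat n) := by
  obtain ⟨body, c, hbody⟩ := exists_search_round hA
  refine ⟨.loop (.seq .right .right) body, c, fun n k B T P hk hT W => ?_⟩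
  have htest : ∀ acc st, (WhileProg.seq .right .right).Runs (searchTree n k acc st)
      (.ofList BranchState.encode st) 3 := fun acc st => .seq (.right _) (.right _)
  -- Each round lowers the total weight of the stack by at least one, so `W` bounds the number of
  -- rounds. For `W = 0` the stack must be empty.
  induction W with
  | zero =>
    intro acc st hst hW
    rcases st with _ | ⟨s, st⟩
    · exact ⟨acc, _, WhileProg.Runs.loop_stop (htest acc []), by omega, by simp⟩
    · obtain ⟨h, hP⟩ := hst s (by simp)
      obtain ⟨_, _, _, _, _, _, _, hw⟩ := hbody n k B T P acc s st hk h (hT s h) hP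
      simp only [List.map_cons, List.sum_cons] at hW
      omega
  | succ W ih =>
    intro acc st hst hW
    rcases st with _ | ⟨s, st⟩
    · exact ⟨acc, _, WhileProg.Runs.loop_stop (htest acc []), by omega, by simp⟩
    · obtain ⟨h, hP⟩ := hst s (by simp)
      obtain ⟨acc1, new, t1, h1, ht1, hnew, hsat, hw⟩ :=
        hbody n k B T P acc s st hk h (hT s h) hP
      simp only [List.map_cons, List.sum_cons] at hW
      obtain ⟨acc2, t2, h2, ht2, hsat2⟩ := ih acc1 (new ++ st)
        (by
          intro s' hs'
          rcases List.mem_append.1 hs' with hs' | hs'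
          exacts [hnew s' hs', hst s' (by simp [hs'])])
        (by
          rw [List.map_append, List.sum_append]
          omega)
      refine ⟨acc2, _, .loop_step (htest acc (s :: st)) h1 h2, ?_, ?_⟩
      · rw [Nat.succ_mul]
        omega
      · rw [hsat2]
        simp only [List.mem_append, or_and_right, exists_or, List.mem_cons, exists_eq_left]
        rw [← or_assoc, hsat, or_assoc]

/-! ## The initial configuration -/

namespace CNFFormula

/-- The clauses, with the variables as natural numbers. -/
def natClauses (F : CNFFormula) : List (List (ℕ × Bool)) :=
  F.clauses.map fun C => C.map fun l => (l.1.val, l.2)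

/-- The root of the branching tree. -/
def root (F : CNFFormula) : BranchState :=
  ⟨(F.natClauses.map fun C => (C.map fun l => 2 * l.1 + l.2.toNat).reverse).reverse,
    [2 * F.numVars], []⟩

/-- The width of the clauses after branching. -/
def width (q : ℕ) (F : CNFFormula) : ℕ := q * (F.clauses.length + 2).size

theorem encode_eq (F : CNFFormula) : F.encode = .node (.ofNat F.numVars)
    (.ofList (.ofList fun l : ℕ × Bool => .node (.ofNat l.1) (.ofBool l.2)) F.natClauses) := by
  rw [natClauses, BinTree.ofList_map]
  simp only [BinTree.ofList_map]
  rfl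

theorem length_clauses_le (F : CNFFormula) : F.clauses.length ≤ F.size := by
  simp [size]

theorem length_le_of_mem (F : CNFFormula) {C : List (Fin F.numVars × Bool)}
    (hC : C ∈ F.clauses) : C.length ≤ F.size :=
  (Nat.le_succ _).trans (List.single_le_sum (fun _ _ => Nat.zero_le _) _
    (List.mem_map_of_mem (f := fun C => C.length + 1) hC))

theorem length_le_of_mem_natClauses (F : CNFFormula) {C : List (ℕ × Bool)}
    (hC : C ∈ F.natClauses) : C.length ≤ F.size := by
  obtain ⟨D, hD, rfl⟩ := List.mem_map.1 hC
  simpa using F.length_le_of_mem hD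

theorem lt_of_mem_natClauses (F : CNFFormula) {C : List (ℕ × Bool)}
    (hC : C ∈ F.natClauses) {l : ℕ × Bool} (hl : l ∈ C) : l.1 < F.numVars := by
  obtain ⟨D, hD, rfl⟩ := List.mem_map.1 hC
  obtain ⟨m, hm, rfl⟩ := List.mem_map.1 hl
  exact m.1.2

theorem sat_root_iff (F : CNFFormula) : F.root.Sat F.numVars ↔ F.Satisfiable := by
  have key : ∀ (σ : ℕ → Bool) (τ : Fin F.numVars → Bool),
      (∀ x : Fin F.numVars, σ (2 * x) = !τ x ∧ σ (2 * x + 1) = τ x) →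
      ((∀ C ∈ F.root.todo, ∃ l ∈ C, σ l = true) ↔ ∀ C ∈ F.clauses, ∃ l ∈ C, τ l.1 = l.2) := by
    intro σ τ h
    have hl : ∀ l : Fin F.numVars × Bool,
        σ (2 * l.1.val + l.2.toNat) = true ↔ τ l.1 = l.2 := by
      rintro ⟨x, b⟩
      cases b <;> simp [h x]
    simp only [root, natClauses, List.map_map, List.mem_reverse, List.forall_mem_map]
    refine forall₂_congr fun C _ => ⟨?_, ?_⟩
    · rintro ⟨l, hmem, hσ⟩
      simp only [Function.comp_apply, List.map_map, List.mem_reverse, List.mem_map] at hmem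
      obtain ⟨m, hm, rfl⟩ := hmem
      exact ⟨m, hm, (hl m).1 hσ⟩
    · rintro ⟨m, hm, hτ⟩
      refine ⟨_, ?_, (hl m).2 hτ⟩
      simp only [Function.comp_apply, List.map_map, List.mem_reverse, List.mem_map]
      exact ⟨m, hm, rfl⟩
  constructor
  · rintro ⟨σ, h1, h2, h3, -⟩
    refine ⟨fun x => σ (2 * x + 1), (key σ _ fun x => ⟨?_, rfl⟩).1 h3⟩
    simp [h1 x x.2.le]
  · rintro ⟨τ, hτ⟩
    -- The default `true` gives the dummy variable the value that makes the literal `2 * n` false.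
    let v : ℕ → Bool := fun x => if h : x < F.numVars then τ ⟨x, h⟩ else true
    let σ : ℕ → Bool := fun l => if l % 2 = 1 then v (l / 2) else !v (l / 2)
    have h0 : ∀ x, σ (2 * x) = !v x := fun x => by simp [σ]
    have h1 : ∀ x, σ (2 * x + 1) = v x := fun x => by
      simp only [σ, show (2 * x + 1) % 2 = 1 by omega, show (2 * x + 1) / 2 = x by omega, if_true]
    refine ⟨σ, fun x _ => by simp [h0, h1], ?_, (key σ τ fun x => ?_).2 hτ, by simp [root]⟩
    · simp [root, h0, v]
    · simp [h0, h1, v]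

/-- A bound for all quantities that occur in the search. -/
def bound (q : ℕ) (F : CNFFormula) : ℕ := (2 * (F.numVars + F.size + 2)) ^ (q + 1)

theorem lt_two_pow_size (F : CNFFormula) :
    F.clauses.length + 2 < 2 ^ (F.clauses.length + 2).size := Nat.lt_size_self _

theorem good_root (q : ℕ) (F : CNFFormula) :
    F.root.Good F.numVars (F.width q) (F.bound q) := by
  have hX : 2 * (F.numVars + F.size + 2) ≤ F.bound q := Nat.le_self_pow (by omega) _
  constructor
  · omega
  · have h1 : 2 ^ (F.clauses.length + 2).size ≤ 2 * (F.numVars + F.size + 2) := by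
      have hpos : 0 < (F.clauses.length + 2).size := Nat.size_pos.2 (by omega)
      have h2 : 2 ^ ((F.clauses.length + 2).size - 1) ≤ F.clauses.length + 2 :=
        Nat.lt_size.1 (by omega)
      obtain ⟨j, hj⟩ : ∃ j, (F.clauses.length + 2).size = j + 1 :=
        ⟨(F.clauses.length + 2).size - 1, by omega⟩
      rw [hj] at h2 ⊢
      have := F.length_clauses_le
      simp only [Nat.add_sub_cancel] at h2
      rw [pow_succ]
      omega
    -- `2 ^ (width + 1)` is the `q`-th power of `2 ^ Nat.size (m + 2)` times `2`, which accounts for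
    -- the exponent `q + 1` in `bound`.
    rw [width, bound, pow_succ, pow_succ, mul_comm q, pow_mul]
    exact Nat.mul_le_mul (Nat.pow_le_pow_left h1 q) (by omega)
  · simp [root]
  · simp [root]
  · simp [root]
  · intro C hC l hl
    simp only [root, List.mem_reverse, List.mem_map] at hC
    obtain ⟨D, hD, rfl⟩ := hC
    simp only [List.mem_reverse, List.mem_map] at hl
    obtain ⟨m, hm, rfl⟩ := hl
    have h1 := F.lt_of_mem_natClauses hD hm
    have h2 := Bool.toNat_le m.2
    omega
  · intro C hC
    simp only [root, List.mem_reverse, List.mem_map] at hC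
    obtain ⟨D, hD, rfl⟩ := hC
    have h1 := F.length_le_of_mem_natClauses hD
    simp only [List.length_reverse, List.length_map]
    omega
  · simp [root]
  · simp [root]
  · simp [root]
  · simp [root]
  · have := F.length_clauses_le
    simp only [root, natClauses, List.length_reverse, List.length_map, List.length_nil]
    omega

end CNFFormula

/-! ### Programs for the width and the literal codes -/

namespace PolyMap

variable {ι : Type} {N : ι → ℕ} {e : ι → BinTree}

theorem length {α : Type} {enc : α → BinTree} {L : ι → List α} (hlen : ∀ i, (L i).length ≤ N i)
    (hL : PolyMap N e (fun i => .ofList enc (L i))) :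
    PolyMap N e (fun i => .ofNat (L i).length) := by
  refine (foldl (encβ := ofNat) (init := fun _ => 0) (step := fun _ r _ => r + 1) hlen hL zero
    fun κ π pre a suf _ => succ (.left (.left .id))).congr (fun _ => rfl) fun i => ?_
  congr 1
  induction L i using List.reverseRecOn <;> simp_all

/-- The binary length is the number of halvings until `0` is reached, and each effective halving
adds `q`. Running `a i` rounds suffices without knowing the length beforehand; surplus rounds change
nothing. -/
theorem mul_size (q : ℕ) {a : ι → ℕ} (ha : PolyMap N e (fun i => .ofNat (a i)))
    (hN : ∀ i, a i ≤ N i) : PolyMap N e (fun i => .ofNat (q * (a i).size)) := by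
  have := iter (s := fun i j => .node (.ofNat (a i / 2 ^ j)) (.ofNat (q * min j (a i).size)))
    hN ha (ha.node zero |>.congr (fun _ => rfl) fun i => by simp) ?_
  · refine this.right.congr (fun _ => rfl) fun i => ?_
    rw [min_eq_right (Nat.size_le.2 Nat.lt_two_pow_self)]
  · intro κ π j _
    have h1 : PolyMap (fun x => N (π x)) (fun x => .node (.node (.ofNat (a (π x) / 2 ^ j x))
        (.ofNat (q * min (j x) (a (π x)).size))) (e (π x)))
        (fun x => .ofNat (a (π x) / 2 ^ j x)) := .left (.left .id)
    refine (h1.ite_ne_zero ((h1.half fun x => (Nat.div_le_self _ _).trans (hN _)).node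
      (addConst (.right (.left .id)) q)) (.left .id)).congr (fun _ => rfl) fun x => ?_
    have hlt : a (π x) / 2 ^ j x ≠ 0 ↔ j x < (a (π x)).size := by
      rw [Nat.lt_size, Ne, Nat.div_eq_zero_iff]
      simp
    have hdiv : a (π x) / 2 ^ j x / 2 = a (π x) / 2 ^ (j x + 1) := by
      rw [Nat.div_div_eq_div_mul, pow_succ]
    rw [← hdiv]
    by_cases h : j x < (a (π x)).size
    · rw [if_pos (hlt.2 h), min_eq_left h.le, min_eq_left (Nat.succ_le_of_lt h), Nat.mul_succ]
    · have h0 : a (π x) / 2 ^ j x = 0 := by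
        by_contra h'
        exact h (hlt.1 h')
      rw [if_neg (by simpa using h0), min_eq_right (by omega), min_eq_right (by omega), h0]

theorem literal {l : ι → ℕ × Bool}
    (hl : PolyMap N e (fun i => .node (.ofNat (l i).1) (.ofBool (l i).2)))
    (hN : ∀ i, (l i).1 ≤ N i) :
    PolyMap N e (fun i => .ofNat (2 * (l i).1 + (l i).2.toNat)) := by
  refine (ite (P := fun i => (l i).2 = true) (hl.right.congr (fun _ => rfl) fun i => by simp)
    (hl.left.double hN).succ (hl.left.double hN)).congr (fun _ => rfl) fun i => ?_
  cases (l i).2 <;> simp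

end PolyMap

theorem polyMap_init (q : ℕ) : PolyMap (fun F : CNFFormula => F.numVars + F.size + 2)
    CNFFormula.encode (fun F => searchTree F.numVars (F.width q) .nil [F.root]) := by
  have hid : PolyMap (fun F : CNFFormula => F.numVars + F.size + 2) CNFFormula.encode
      (fun F => .node (.ofNat F.numVars) (.ofList (.ofList fun l : ℕ × Bool =>
        .node (.ofNat l.1) (.ofBool l.2)) F.natClauses)) :=
    PolyMap.id.congr (fun _ => rfl) CNFFormula.encode_eq
  have hlen : ∀ F : CNFFormula, F.natClauses.length ≤ F.numVars + F.size + 2 := fun F => by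
    have := F.length_clauses_le
    simp only [CNFFormula.natClauses, List.length_map]
    omega
  have hwidth : PolyMap (fun F : CNFFormula => F.numVars + F.size + 2) CNFFormula.encode
      (fun F => .ofNat (F.width q)) := by
    refine (((PolyMap.length hlen hid.right).addConst 2).mul_size q fun F => ?_).congr
      (fun _ => rfl) fun F => by simp [CNFFormula.width, CNFFormula.natClauses]
    have := F.length_clauses_le
    simp only [CNFFormula.natClauses, List.length_map]
    omega
  have htodo : PolyMap (fun F : CNFFormula => F.numVars + F.size + 2) CNFFormula.encode
      (fun F => .ofList (.ofList .ofNat) F.root.todo) := by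
    refine (PolyMap.mapOnto (encβ := .ofList .ofNat) (acc := fun _ => [])
      (φ := fun _ C => (C.map fun l => 2 * l.1 + l.2.toNat).reverse) hlen hid.right .listNil
      fun κ π C hC => ?_).congr (fun _ => rfl) fun F => by rw [List.append_nil]; rfl
    refine (PolyMap.mapOnto (enc := fun l : ℕ × Bool => .node (.ofNat l.1) (.ofBool l.2))
      (encβ := .ofNat) (L := C) (acc := fun _ => [])
      (φ := fun _ l => 2 * l.1 + l.2.toNat) (fun j => ?_) (.left .id) .listNil
      fun κ' π' l hl => ?_).congr (fun _ => rfl) fun j => by rw [List.append_nil]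
    · have := (π j).length_le_of_mem_natClauses (hC j)
      omega
    · refine PolyMap.literal (.left .id) fun j => ?_
      have := (π (π' j)).lt_of_mem_natClauses (hC (π' j)) (hl j)
      omega
  exact (hid.left.node hwidth).node ((PolyMap.const .nil).node (.listCons
    (htodo.node ((PolyMap.listCons (hid.left.double fun F => by omega) .listNil).node .listNil))
    .listNil))

/-! ## Running times -/

/-- `f X` is at most a fixed power of `X`, for `2 ≤ X`. -/
def PowerBounded (f : ℕ → ℕ) : Prop := ∃ D, ∀ X, 2 ≤ X → f X ≤ X ^ D

namespace PowerBounded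

variable {f g : ℕ → ℕ}

theorem const (c : ℕ) : PowerBounded fun _ => c :=
  ⟨c, fun _ hX => Nat.lt_two_pow_self.le.trans (Nat.pow_le_pow_left hX c)⟩

theorem id : PowerBounded fun X => X := ⟨1, fun X _ => by simp⟩

theorem add (hf : PowerBounded f) (hg : PowerBounded g) : PowerBounded fun X => f X + g X := by
  obtain ⟨c, hc⟩ := hf
  obtain ⟨d, hd⟩ := hg
  exact ⟨c + d + 2, fun X hX =>
    (Nat.le_succ _).trans (add_add_one_le_pow hX (hc X hX) (hd X hX))⟩

theorem mul (hf : PowerBounded f) (hg : PowerBounded g) : PowerBounded fun X => f X * g X := by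
  obtain ⟨c, hc⟩ := hf
  obtain ⟨d, hd⟩ := hg
  exact ⟨c + d, fun X hX => pow_add X c d ▸ Nat.mul_le_mul (hc X hX) (hd X hX)⟩

theorem pow (hf : PowerBounded f) (m : ℕ) : PowerBounded fun X => f X ^ m := by
  obtain ⟨c, hc⟩ := hf
  exact ⟨c * m, fun X hX => pow_mul X c m ▸ Nat.pow_le_pow_left (hc X hX) m⟩

end PowerBounded

/-- Powers grow more slowly than exponential functions. -/
theorem exists_pow_le_rpow (D : ℕ) {δ : ℝ} (hδ : 0 < δ) :
    ∃ C : ℝ, ∀ n : ℕ, ((n : ℝ) + 2) ^ D ≤ C * (2 : ℝ) ^ (δ * n) := by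
  have hr : 1 < (2 : ℝ) ^ δ := Real.one_lt_rpow (by norm_num) hδ
  have h := (tendsto_pow_const_div_const_pow_of_one_lt D hr).bddAbove_range
  obtain ⟨K, hK⟩ := h
  refine ⟨K * ((2 : ℝ) ^ δ) ^ 2, fun n => ?_⟩
  have h1 := hK (Set.mem_range_self (n + 2))
  have hpos : 0 < ((2 : ℝ) ^ δ) ^ (n + 2) := by positivity
  rw [div_le_iff₀ hpos] at h1
  push_cast at h1
  rw [Real.rpow_mul (by norm_num), Real.rpow_natCast]
  calc _ ≤ _ := h1
    _ = _ := by ring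

/-- The factor `Nat.size (m + 2)` occurs in the exponent of the base `P` and in the width by which
the exponent is divided, so it cancels up to rounding and only `q` remains. -/
theorem weight_root_le {q : ℕ} (F : CNFFormula) :
    F.root.weight F.numVars (F.width q) (2 ^ (F.clauses.length + 2).size) ≤
      (F.clauses.length + 1) * 2 ^ ((2 * F.numVars + 1) / q) := by
  simp only [BranchState.weight, CNFFormula.root, CNFFormula.natClauses, List.length_reverse,
    List.length_map, List.length_singleton, CNFFormula.width, ← pow_mul]
  refine Nat.mul_le_mul_left _ (Nat.pow_le_pow_right (by omega) ?_)
  rw [← Nat.div_div_eq_div_mul]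
  exact Nat.mul_div_le _ _

theorem two_pow_div_le (m q : ℕ) : ((2 ^ (m / q) : ℕ) : ℝ) ≤ (2 : ℝ) ^ ((m : ℝ) / q) := by
  push_cast
  rw [← Real.rpow_natCast]
  exact Real.rpow_le_rpow_of_exponent_le (by norm_num) Nat.cast_div_le

/-- The running time of the search, up to an exponential factor. -/
def timePolynomial (a b c q X : ℕ) : ℕ :=
  (X + 2) ^ a + 2 * X * (((2 * X) ^ (q + 1) + 2) ^ b +
    4 * c * (3 * ((2 * X) ^ (q + 1)) ^ 3 + 1) ^ c + 4) + 20

theorem powerBounded_timePolynomial (a b c q : ℕ) : PowerBounded (timePolynomial a b c q) := by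
  have hB := ((PowerBounded.const 2).mul .id).pow (q + 1)
  exact (((PowerBounded.id.add (.const 2)).pow a).add (((PowerBounded.const 2).mul .id).mul
    ((((hB.add (.const 2)).pow b).add ((PowerBounded.const (4 * c)).mul
    ((((PowerBounded.const 3).mul (hB.pow 3)).add (.const 1)).pow c))).add (.const 4)))).add
    (.const 20)

/-- The search solves CNF-Sat, with a running time that is exponential only in `4 * n / q`. -/
theorem exists_cnfSat_program (h : BooleanCSPNonuniformSubexp) (q : ℕ) (hq : 0 < q) :
    ∃ (p : WhileProg) (D : ℕ), ∀ F : CNFFormula, ∃ out t, p.Runs F.encode out t ∧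
      (out ≠ .nil ↔ F.Satisfiable) ∧
      (t : ℝ) ≤ ((F.numVars + F.size + 2 : ℕ) : ℝ) ^ D * (2 : ℝ) ^ (4 * F.numVars / q : ℝ) := by
  obtain ⟨A, c, hA⟩ := h q hq
  have hA' : ∀ I : BoolCSP, ∃ out t, A.Runs I.encode out t ∧ (out ≠ .nil ↔ I.Consistent) ∧
      t ≤ ⌊c * (2 : ℝ) ^ ((1 / (q : ℝ)) * (I.numVars : ℝ)) * ((I.size : ℝ) + 1) ^ c⌋₊ := by
    intro I
    obtain ⟨out, t, h1, h2, h3⟩ := hA I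
    exact ⟨out, t, h1, h2, Nat.le_floor h3⟩
  obtain ⟨search, b, hsearch⟩ := exists_search hA'
  obtain ⟨init, a, hinit⟩ := polyMap_init q
  obtain ⟨D, hD⟩ := powerBounded_timePolynomial a b c q
  refine ⟨.seq init (.seq search (.seq .right .left)), D, fun F => ?_⟩
  obtain ⟨t1, h1, ht1⟩ := hinit F
  have hk : 0 < F.width q := Nat.mul_pos hq (Nat.size_pos.2 (by omega))
  -- One time bound for all leaves: each CSP has `2 * n + 2` variables and size at most `3 * B ^ 3`.
  obtain ⟨T, hTdef⟩ : ∃ T, T = ⌊c * (2 : ℝ) ^ ((1 / (q : ℝ)) * ((2 * F.numVars + 2 : ℕ) : ℝ)) *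
    (((3 * F.bound q ^ 3 : ℕ) : ℝ) + 1) ^ c⌋₊ := ⟨_, rfl⟩
  obtain ⟨acc, t2, h2, ht2, hacc⟩ := hsearch F.numVars (F.width q) (F.bound q) T
    (2 ^ (F.clauses.length + 2).size) hk
    (by
      intro s hs
      rw [hTdef]
      refine Nat.floor_le_floor ?_
      have hsize : (hs.csp.size : ℝ) ≤ ((3 * F.bound q ^ 3 : ℕ) : ℝ) :=
        Nat.cast_le.2 hs.size_csp_le
      show c * (2 : ℝ) ^ ((1 / (q : ℝ)) * ((2 * F.numVars + 2 : ℕ) : ℝ)) *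
        ((hs.csp.size : ℝ) + 1) ^ c ≤ _
      gcongr)
    ((F.clauses.length + 1) * 2 ^ ((2 * F.numVars + 1) / q)) .nil [F.root]
    (by
      intro s hs
      obtain rfl := List.mem_singleton.1 hs
      refine ⟨F.good_root q, ?_⟩
      have := F.lt_two_pow_size
      simp only [CNFFormula.root, CNFFormula.natClauses, List.length_reverse, List.length_map]
      omega)
    (by simpa using weight_root_le F)
  refine ⟨acc, _, .seq h1 (.seq h2 (.seq (.right _) (.left _))), ?_, ?_⟩
  · rw [hacc]
    simp [F.sat_root_iff]
  · obtain ⟨X, hX⟩ : ∃ X, X = F.numVars + F.size + 2 := ⟨_, rfl⟩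
    -- `U` is the exponential part of both the number of nodes and the time per leaf. The additive
    -- `1` and `2` in their exponents `(2 * n + 1) / q` and `(2 * n + 2) / q` cost at most the
    -- factors `2` and `4`.
    obtain ⟨U, hU⟩ : ∃ U : ℝ, U = (2 : ℝ) ^ (2 * F.numVars / q : ℝ) := ⟨_, rfl⟩
    have hU1 : 1 ≤ U := hU ▸ Real.one_le_rpow (by norm_num) (by positivity)
    have hq1 : (1 : ℝ) / q ≤ 1 := by
      rw [div_le_one (by positivity)]
      exact_mod_cast hq
    have hW : (((F.clauses.length + 1) * 2 ^ ((2 * F.numVars + 1) / q) : ℕ) : ℝ) ≤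
        2 * X * U := by
      have h3 : (2 : ℝ) ^ (((2 * F.numVars + 1 : ℕ) : ℝ) / q) ≤ 2 * U := by
        rw [hU, show (2 : ℝ) * 2 ^ (2 * F.numVars / q : ℝ) = 2 ^ (1 + 2 * F.numVars / q : ℝ) by
          rw [Real.rpow_add (by norm_num), Real.rpow_one]]
        refine Real.rpow_le_rpow_of_exponent_le (by norm_num) ?_
        push_cast
        rw [add_div]
        linarith
      have h4 : ((F.clauses.length + 1 : ℕ) : ℝ) ≤ X := by
        have := F.length_clauses_le
        exact_mod_cast (by omega : F.clauses.length + 1 ≤ X)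
      rw [Nat.cast_mul]
      calc _ ≤ (X : ℝ) * (2 * U) :=
            mul_le_mul h4 ((two_pow_div_le _ _).trans h3) (by positivity) (by positivity)
        _ = 2 * X * U := by ring
    have hB : F.bound q = (2 * X) ^ (q + 1) := by rw [CNFFormula.bound, hX]
    have hT : (T : ℝ) ≤ ((4 * c * (3 * ((2 * X) ^ (q + 1)) ^ 3 + 1) ^ c : ℕ) : ℝ) * U := by
      have h3 : (2 : ℝ) ^ ((1 / (q : ℝ)) * ((2 * F.numVars + 2 : ℕ) : ℝ)) ≤ 4 * U := by
        rw [hU, show (4 : ℝ) * 2 ^ (2 * F.numVars / q : ℝ) = 2 ^ (2 + 2 * F.numVars / q : ℝ) by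
          rw [Real.rpow_add (by norm_num)]; norm_num]
        refine Real.rpow_le_rpow_of_exponent_le (by norm_num) ?_
        push_cast
        calc (1 / (q : ℝ)) * (2 * F.numVars + 2)
            = 2 * (1 / (q : ℝ)) + 2 * F.numVars / q := by ring
          _ ≤ _ := by linarith
      rw [hTdef, hB]
      refine (Nat.floor_le (by positivity)).trans ?_
      calc _ ≤ (c : ℝ) * (4 * U) * (((3 * ((2 * X) ^ (q + 1)) ^ 3 : ℕ) : ℝ) + 1) ^ c := by gcongr
        _ = _ := by push_cast; ring
    have hUU : (2 : ℝ) ^ (4 * F.numVars / q : ℝ) = U * U := by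
      rw [hU, ← Real.rpow_add (by norm_num)]
      congr 1
      ring
    rw [hUU, ← hX]
    have hDX : ((timePolynomial a b c q X : ℕ) : ℝ) ≤ (X : ℝ) ^ D := by
      exact_mod_cast hD X (by omega)
    refine le_trans ?_ (mul_le_mul_of_nonneg_right hDX (by positivity))
    rw [hB] at ht2
    simp only [← hX] at ht1
    simp only [timePolynomial]
    generalize 4 * c * (3 * ((2 * X) ^ (q + 1)) ^ 3 + 1) ^ c = Y at hT ⊢
    generalize ((2 * X) ^ (q + 1) + 2) ^ b = Z at ht2 ⊢
    generalize (X + 2) ^ a = V at ht1 ⊢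
    have h3 : (t1 : ℝ) ≤ V := by exact_mod_cast ht1
    have h4 : (t2 : ℝ) ≤
        (((F.clauses.length + 1) * 2 ^ ((2 * F.numVars + 1) / q) : ℕ) : ℝ) * (Z + T + 4) + 4 := by
      exact_mod_cast ht2
    have hUU1 : U ≤ U * U := by nlinarith
    have h5 : (Z : ℝ) + T + 4 ≤ (Z + Y + 4) * U := by
      have : (Z : ℝ) + 4 ≤ (Z + 4) * U := le_mul_of_one_le_right (by positivity) hU1
      linarith
    have h6 : (t2 : ℝ) ≤ 2 * X * U * ((Z + Y + 4) * U) + 4 :=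
      h4.trans (add_le_add_left (mul_le_mul hW h5 (by positivity) (by positivity)) _)
    have h7 : (V : ℝ) + 20 ≤ (V + 20) * (U * U) :=
      le_mul_of_one_le_right (by positivity) (hU1.trans hUU1)
    push_cast
    linarith

theorem mainTheorem4 (h : BooleanCSPNonuniformSubexp) : CNFSatNonuniformSubexp := by
  intro ℓ hℓ
  have hℓ' : (0 : ℝ) < ℓ := by exact_mod_cast hℓ
  -- With `q = 6 * ℓ` the search costs `2 ^ (2 * n / (3 * ℓ))`. The remaining `2 ^ (n / (3 * ℓ))`
  -- absorbs a power of `n + 2`, which is necessary because the size of a formula does not bound its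
  -- number of variables.
  obtain ⟨p, D, hp⟩ := exists_cnfSat_program h (6 * ℓ) (by omega)
  obtain ⟨C, hC⟩ := exists_pow_le_rpow D (δ := 1 / (3 * ℓ)) (by positivity)
  refine ⟨p, max D ⌈C⌉₊, fun F => ?_⟩
  obtain ⟨out, t, h1, h2, h3⟩ := hp F
  refine ⟨out, t, h1, h2, h3.trans ?_⟩
  have hsplit : ((F.numVars + F.size + 2 : ℕ) : ℝ) ≤ ((F.numVars : ℝ) + 2) * ((F.size : ℝ) + 1) := by
    have : (0 : ℝ) ≤ (F.numVars : ℝ) * F.size := by positivity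
    push_cast
    nlinarith [(Nat.cast_nonneg F.size : (0 : ℝ) ≤ F.size)]
  have hexp : (2 : ℝ) ^ (1 / (3 * ℓ) * F.numVars : ℝ) *
      (2 : ℝ) ^ (4 * F.numVars / (6 * ℓ : ℕ) : ℝ) = (2 : ℝ) ^ (1 / (ℓ : ℝ) * F.numVars) := by
    rw [← Real.rpow_add (by norm_num)]
    congr 1
    push_cast
    field_simp
    ring
  have hC' : C ≤ (max D ⌈C⌉₊ : ℕ) :=
    (Nat.le_ceil C).trans (Nat.cast_le.2 (le_max_right _ _))
  have hsize : (1 : ℝ) ≤ (F.size : ℝ) + 1 := by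
    linarith [(Nat.cast_nonneg F.size : (0 : ℝ) ≤ F.size)]
  calc ((F.numVars + F.size + 2 : ℕ) : ℝ) ^ D * (2 : ℝ) ^ (4 * F.numVars / (6 * ℓ : ℕ) : ℝ)
      ≤ (((F.numVars : ℝ) + 2) * ((F.size : ℝ) + 1)) ^ D *
          (2 : ℝ) ^ (4 * F.numVars / (6 * ℓ : ℕ) : ℝ) := by gcongr
    _ = ((F.numVars : ℝ) + 2) ^ D * (2 : ℝ) ^ (4 * F.numVars / (6 * ℓ : ℕ) : ℝ) *
          ((F.size : ℝ) + 1) ^ D := by rw [mul_pow]; ring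
    _ ≤ C * (2 : ℝ) ^ (1 / (3 * ℓ) * F.numVars : ℝ) *
          (2 : ℝ) ^ (4 * F.numVars / (6 * ℓ : ℕ) : ℝ) * ((F.size : ℝ) + 1) ^ D := by
        gcongr
        exact hC F.numVars
    _ = C * (2 : ℝ) ^ (1 / (ℓ : ℝ) * F.numVars) * ((F.size : ℝ) + 1) ^ D := by
        rw [mul_assoc C, hexp]
    _ ≤ _ := by
        gcongr
        exact le_max_left _ _
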